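/- Let $R=\mathbb Z[A^{\pm1},d^{-1}]$, where $d=-A^2-A^{-2}$. For $n\ge 0$, a ribbon $n$-graph is represented by a planar diagram in $\mathbb R\times[0,1]$ with $n$ boundary points on the top line and $n$ on the bottom line, made of vertices, edges (possibly ending at boundary points), circles and crossings with over/under information. (Vertices of any valency are allowed, and a vertex of valency two is regarded as an interior point of an edge.) Diagrams are taken up to planar isotopy and the extended Reidemeister moves for ribbon graphs (cancellation of two opposite kinks, the second and third Reidemeister moves, and moving a strand over or under a vertex). Let $\mathcal Y_n$ be the quotient of the free $R$-module on the ribbon $n$-graphs by the submodule generated by the Yamada skein relations, in which the diagrams are identical outside a small disc: 1. $D_{\text{cross}} = A^{4}D_0 + A^{-4}D_\infty - d\,D_\bullet$, where $D_0$ and $D_\infty$ are the two smoothings of a crossing (in the convention in which the Kauffman bracket relation is $L=A L_0+A^{-1}L_\infty$) and $D_\bullet$ has a vertex of valency four in place of the crossing; 2. $D = D/e - d^{-1}(D-e)$ for an edge $e$ joining two different vertices, where $D/e$ and $D-e$ are obtained by contracting and by deleting $e$; 3. $D=(d-d^{-1})D'$, where $D'$ is obtained from $D$ by deleting a small loop at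 a vertex; 4. $D=(d^2-1)D'$, where $D'$ is obtained from $D$ by deleting a small circle without vertices. The product $GG'$ given by placing $G$ above $G'$ makes $\mathcal Y_n$ an $R$-algebra, with unit $1_n$ given by $n$ vertical strands. In $\mathcal Y_2$ let $V$ be the class of the diagram consisting of one arc joining the two top boundary points and one arc joining the two bottom boundary points, and let $X$ be the class of the diagram with a single vertex, of valency four, joined to the four boundary points. Then there is an isomorphism of $R$-algebras from the quotient of the commutative polynomial algebra $R[X,V]$ by the ideal generated by $$V^2-(d^2-1)V,\qquad VX-(d-d^{-1})V,\qquad X^2-(d-2d^{-1})X-d^{-2}V$$ onto $\mathcal Y_2$, and it sends the variables $X$ and $V$ to the elements $X$ and $V$ of $\mathcal Y_2$. -/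

import Mathlib

namespace RibbonSkein

noncomputable section

/-! ### The coefficient ring `ℤ[A^{±1}, d⁻¹]` with `d = -A² - A⁻²` -/

/-- The Laurent polynomial `d = -A² - A⁻²`. -/
def dLaurent : LaurentPolynomial ℤ :=
  -(LaurentPolynomial.T 2) - LaurentPolynomial.T (-2)

/-- The ring `ℤ[A^{±1}, d⁻¹]`. -/
abbrev SkeinRing : Type := Localization.Away dLaurent

/-- The variable `A`. -/
def A : SkeinRing := algebraMap (LaurentPolynomial ℤ) SkeinRing (LaurentPolynomial.T 1)

/-- The inverse `A⁻¹`. -/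
def Ainv : SkeinRing := algebraMap (LaurentPolynomial ℤ) SkeinRing (LaurentPolynomial.T (-1))

/-- The element `d = -A² - A⁻²`. -/
def d : SkeinRing := -A ^ 2 - Ainv ^ 2

/-- The inverse `d⁻¹`. -/
def dinv : SkeinRing := IsLocalization.Away.invSelf dLaurent

theorem A_mul_Ainv : A * Ainv = 1 := by
  rw [A, Ainv, ← map_mul, ← LaurentPolynomial.T_add]
  simp

theorem d_mul_dinv : d * dinv = 1 := by
  have h : d = algebraMap (LaurentPolynomial ℤ) SkeinRing dLaurent := by
    simp only [d, A, Ainv, dLaurent, map_sub, map_neg, ← map_pow, LaurentPolynomial.T_pow]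
    norm_num
  rw [h, dinv]
  exact IsLocalization.Away.mul_invSelf _

/-! ### Planar diagrams of ribbon graphs

A diagram in the strip `ℝ × [0,1]` in general position is cut by horizontal lines into layers, each
of which contains one elementary piece and otherwise vertical strands only. Diagrams are read from
top to bottom, and strands are numbered from left to right. -/

/-- The elementary pieces.
* `cap` is the local maximum `∩`;
* `cup` is the local minimum `∪`;
* `vertex p q` is a vertex of valency `p + q` (the picture of a coupon) with `p` edge germs leaving
  upwards and `q` edge germs leaving downwards;
* `crossing b` is a crossing of two strands. If `b = true` the strand which runs from the top left
  to the bottom right passes over, if `b = false` the strand which runs from the top right to the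
  bottom left passes over. -/
inductive Piece : Type
  | cap : Piece
  | cup : Piece
  | vertex (p q : ℕ) : Piece
  | crossing (b : Bool) : Piece

/-- The number of strands which enter a piece from above. -/
def Piece.top : Piece → ℕ
  | .cap => 0
  | .cup => 2
  | .vertex p _ => p
  | .crossing _ => 2

/-- The number of strands which leave a piece below. -/
def Piece.bot : Piece → ℕ
  | .cap => 2
  | .cup => 0
  | .vertex _ q => q
  | .crossing _ => 2

/-- A layer: one elementary piece with `left` vertical strands to its left and `right` vertical
strands to its right. -/
structure Layer : Type where
  left : ℕ
  piece : Piece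
  right : ℕ

/-- The number of points on the upper boundary of a layer. -/
def Layer.top (L : Layer) : ℕ := L.left + L.piece.top + L.right

/-- The number of points on the lower boundary of a layer. -/
def Layer.bot (L : Layer) : ℕ := L.left + L.piece.bot + L.right

/-- `Composable m w n`: the layers of `w`, stacked from top to bottom, fit together to a diagram
with `m` boundary points on the top line and `n` boundary points on the bottom line. -/
def Composable : ℕ → List Layer → ℕ → Prop
  | m, [], n => m = n
  | m, L :: w, n => L.top = m ∧ Composable L.bot w n

theorem Composable.append {m n k : ℕ} {u v : List Layer}
    (hu : Composable m u n) (hv : Composable n v k) : Composable m (u ++ v) k := by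
  induction u generalizing m with
  | nil =>
    simp only [Composable] at hu
    subst hu
    simpa using hv
  | cons L u ih => exact ⟨hu.1, ih hu.2⟩

/-- A ribbon `n`-graph diagram in general position, cut into layers: it has `n` boundary points on
the top line and `n` on the bottom line. -/
def LayeredDiagram (n : ℕ) : Type := {w : List Layer // Composable n w n}

/-- Layered diagrams are multiplied by stacking, the first factor above the second one; the unit is
the diagram made of `n` vertical strands. -/
instance (n : ℕ) : Monoid (LayeredDiagram n) where
  mul u v := ⟨u.1 ++ v.1, u.2.append v.2⟩
  one := ⟨[], rfl⟩
  mul_assoc u v w := Subtype.ext (List.append_assoc u.1 v.1 w.1)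
  one_mul u := Subtype.ext (List.nil_append u.1)
  mul_one u := Subtype.ext (List.append_nil u.1)

/-- A kink: a strand with `l` strands to its left and `r` to its right makes one full turn and
crosses itself once. -/
def kink (l : ℕ) (b : Bool) (r : ℕ) : List Layer :=
  [⟨l + 1, .cap, r⟩, ⟨l, .crossing b, r + 1⟩, ⟨l + 1, .cup, r⟩]

/-- The strand in position `l` crosses, from left to right, the next `q` strands. It passes over
all of them if `b = true` and under all of them if `b = false`. -/
def passRight (l : ℕ) (b : Bool) (q r : ℕ) : List Layer :=
  (List.range q).map fun i => ⟨l + i, .crossing b, q - 1 - i + r⟩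

/-- The local moves on layered diagrams. The first group generates planar isotopy (together with
the convention that a point of valency two in the interior of an edge is not a vertex), the second
group consists of the extended Reidemeister moves for ribbon graphs. -/
inductive Move : List Layer → List Layer → Prop
  /-- Two pieces placed side by side may exchange their heights. -/
  | interchange (l : ℕ) (g : Piece) (m : ℕ) (h : Piece) (r : ℕ) :
      Move [⟨l, g, m + h.top + r⟩, ⟨l + g.bot + m, h, r⟩]
        [⟨l + g.top + m, h, r⟩, ⟨l, g, m + h.bot + r⟩]
  /-- A maximum and a minimum next to each other on the same strand cancel. -/
  | snake_left (l r : ℕ) : Move [⟨l + 1, .cap, r⟩, ⟨l, .cup, r + 1⟩] []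
  | snake_right (l r : ℕ) : Move [⟨l, .cap, r + 1⟩, ⟨l + 1, .cup, r⟩] []
  /-- The last lower edge germ of a vertex may be bent upwards, on the right. -/
  | bend_right (l p q r : ℕ) :
      Move [⟨l, .vertex p (q + 1), r + 1⟩, ⟨l + q, .cup, r⟩] [⟨l, .vertex (p + 1) q, r⟩]
  /-- The first lower edge germ of a vertex may be bent upwards, on the left. -/
  | bend_left (l p q r : ℕ) :
      Move [⟨l + 1, .vertex p (q + 1), r⟩, ⟨l, .cup, q + r⟩] [⟨l, .vertex (p + 1) q, r⟩]
  /-- A strand which crosses one branch of a minimum may be moved to the other branch. -/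
  | crossing_cup (l : ℕ) (b : Bool) (r : ℕ) :
      Move [⟨l + 1, .crossing b, r⟩, ⟨l, .cup, r + 1⟩]
        [⟨l, .crossing (!b), r + 1⟩, ⟨l + 1, .cup, r⟩]
  /-- A strand which crosses one branch of a maximum may be moved to the other branch. -/
  | crossing_cap (l : ℕ) (b : Bool) (r : ℕ) :
      Move [⟨l, .cap, r + 1⟩, ⟨l + 1, .crossing b, r⟩]
        [⟨l + 1, .cap, r⟩, ⟨l, .crossing (!b), r + 1⟩]
  /-- A vertex of valency two is an interior point of an edge. -/
  | two_valent (l r : ℕ) : Move [⟨l, .vertex 1 1, r⟩] []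
  /-- Framed first Reidemeister move: two opposite kinks cancel. -/
  | reidemeister_one (l : ℕ) (b : Bool) (r : ℕ) : Move (kink l b r ++ kink l (!b) r) []
  /-- Second Reidemeister move. -/
  | reidemeister_two (l : ℕ) (b : Bool) (r : ℕ) :
      Move [⟨l, .crossing b, r⟩, ⟨l, .crossing (!b), r⟩] []
  /-- Third Reidemeister move. -/
  | reidemeister_three (l : ℕ) (b : Bool) (r : ℕ) :
      Move [⟨l, .crossing b, r + 1⟩, ⟨l + 1, .crossing b, r⟩, ⟨l, .crossing b, r + 1⟩]
        [⟨l + 1, .crossing b, r⟩, ⟨l, .crossing b, r + 1⟩, ⟨l + 1, .crossing b, r⟩]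
  /-- A strand may be moved over or under a vertex. -/
  | vertex_slide (l : ℕ) (b : Bool) (q r : ℕ) :
      Move (⟨l + 1, .vertex 0 q, r⟩ :: passRight l b q r) [⟨l, .vertex 0 q, r + 1⟩]

/-- Two layered diagrams are related if one move, performed in a horizontal slab, transforms the
first one into the second one. -/
def Step (n : ℕ) (x y : LayeredDiagram n) : Prop :=
  ∃ above u v below : List Layer, Move u v ∧
    x.1 = above ++ u ++ below ∧ y.1 = above ++ v ++ below

/-- The monoid of ribbon `n`-graphs, represented by diagrams up to planar isotopy and extended
Reidemeister moves; the product puts the first factor above the second one. -/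
abbrev RibbonGraph (n : ℕ) : Type := (conGen (Step n)).Quotient

/-- The ribbon graph represented by a layered diagram. -/
def toGraph {n : ℕ} (x : LayeredDiagram n) : RibbonGraph n := (x : (conGen (Step n)).Quotient)

/-! ### The skein algebra -/

/-- The free module on the set of ribbon `n`-graphs, with the bilinear extension of the product. -/
abbrev FreeGraphModule (n : ℕ) : Type := MonoidAlgebra SkeinRing (RibbonGraph n)

/-- The basis element of the free module given by a layered diagram. -/
def basis {n : ℕ} (x : LayeredDiagram n) : FreeGraphModule n :=
  MonoidAlgebra.of SkeinRing (RibbonGraph n) (toGraph x)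

/-- The coefficient of the smoothing `)(` of a crossing; the coefficient of the smoothing with a
minimum above a maximum is `smoothingCoeff (!b)`. -/
def smoothingCoeff (b : Bool) : SkeinRing := if b then Ainv ^ 4 else A ^ 4

/-- The Yamada skein relators. In each of them the diagrams are identical except in a small disc. -/
inductive YamadaRelator (n : ℕ) : FreeGraphModule n → Prop
  /-- A crossing is `A^{±4}` times one smoothing plus `A^{∓4}` times the other smoothing minus `d`
  times the diagram in which the crossing is replaced by a vertex of valency four. -/
  | crossing (above below : List Layer) (l : ℕ) (b : Bool) (r : ℕ)
      (x x₀ x₁ x₂ : LayeredDiagram n)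
      (hx : x.1 = above ++ [⟨l, .crossing b, r⟩] ++ below)
      (hx₀ : x₀.1 = above ++ [] ++ below)
      (hx₁ : x₁.1 = above ++ [⟨l, .cup, r⟩, ⟨l, .cap, r⟩] ++ below)
      (hx₂ : x₂.1 = above ++ [⟨l, .vertex 2 2, r⟩] ++ below) :
      YamadaRelator n (basis x - (smoothingCoeff b • basis x₀ + smoothingCoeff (!b) • basis x₁
        - d • basis x₂))
  /-- Deletion and contraction of an edge which joins two different vertices: the diagram is the
  contraction minus `d⁻¹` times the deletion. -/
  | deletion_contraction (above below : List Layer) (l p q r : ℕ)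
      (x x₀ x₁ : LayeredDiagram n)
      (hx : x.1 = above ++ [⟨l, .vertex p 1, r⟩, ⟨l, .vertex 1 q, r⟩] ++ below)
      (hx₀ : x₀.1 = above ++ [⟨l, .vertex p q, r⟩] ++ below)
      (hx₁ : x₁.1 = above ++ [⟨l, .vertex p 0, r⟩, ⟨l, .vertex 0 q, r⟩] ++ below) :
      YamadaRelator n (basis x - (basis x₀ - dinv • basis x₁))
  /-- A small loop at a vertex may be removed at the cost of a factor `d - d⁻¹`. -/
  | loop (above below : List Layer) (l p r : ℕ)
      (x x₀ : LayeredDiagram n)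
      (hx : x.1 = above ++ [⟨l, .vertex p 2, r⟩, ⟨l, .cup, r⟩] ++ below)
      (hx₀ : x₀.1 = above ++ [⟨l, .vertex p 0, r⟩] ++ below) :
      YamadaRelator n (basis x - (d - dinv) • basis x₀)
  /-- A small circle without vertices may be removed at the cost of a factor `d² - 1`. -/
  | circle (above below : List Layer) (l r : ℕ)
      (x x₀ : LayeredDiagram n)
      (hx : x.1 = above ++ [⟨l, .cap, r⟩, ⟨l, .cup, r⟩] ++ below)
      (hx₀ : x₀.1 = above ++ [] ++ below) :
      YamadaRelator n (basis x - (d ^ 2 - 1) • basis x₀)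

/-- The smallest submodule which contains all Yamada skein relators. -/
def yamadaSubmodule (n : ℕ) : Submodule SkeinRing (FreeGraphModule n) :=
  Submodule.span SkeinRing {x | YamadaRelator n x}

theorem basis_mul {n : ℕ} (x y : LayeredDiagram n) : basis x * basis y = basis (x * y) := by
  rw [basis, basis, basis, ← map_mul]
  rfl

theorem exists_basis {n : ℕ} (g : RibbonGraph n) :
    ∃ x : LayeredDiagram n, MonoidAlgebra.of SkeinRing (RibbonGraph n) g = basis x := by
  induction g using Con.induction_on with
  | H x => exact ⟨x, rfl⟩

theorem YamadaRelator.basis_mul_left {n : ℕ} {f : FreeGraphModule n} (hf : YamadaRelator n f)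
    (y : LayeredDiagram n) : YamadaRelator n (basis y * f) := by
  have key : ∀ {x : LayeredDiagram n} {above u below : List Layer},
      x.1 = above ++ u ++ below → (y * x).1 = (y.1 ++ above) ++ u ++ below := by
    intro x above u below h
    change y.1 ++ x.1 = _
    simp [h]
  cases hf with
  | crossing above below l b r x x₀ x₁ x₂ hx hx₀ hx₁ hx₂ =>
    simp only [mul_sub, mul_add, mul_smul_comm, basis_mul]
    exact .crossing _ _ l b r _ _ _ _ (key hx) (key hx₀) (key hx₁) (key hx₂)
  | deletion_contraction above below l p q r x x₀ x₁ hx hx₀ hx₁ =>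
    simp only [mul_sub, mul_smul_comm, basis_mul]
    exact .deletion_contraction _ _ l p q r _ _ _ (key hx) (key hx₀) (key hx₁)
  | loop above below l p r x x₀ hx hx₀ =>
    simp only [mul_sub, mul_smul_comm, basis_mul]
    exact .loop _ _ l p r _ _ (key hx) (key hx₀)
  | circle above below l r x x₀ hx hx₀ =>
    simp only [mul_sub, mul_smul_comm, basis_mul]
    exact .circle _ _ l r _ _ (key hx) (key hx₀)

theorem YamadaRelator.basis_mul_right {n : ℕ} {f : FreeGraphModule n} (hf : YamadaRelator n f)
    (y : LayeredDiagram n) : YamadaRelator n (f * basis y) := by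
  have key : ∀ {x : LayeredDiagram n} {above u below : List Layer},
      x.1 = above ++ u ++ below → (x * y).1 = above ++ u ++ (below ++ y.1) := by
    intro x above u below h
    change x.1 ++ y.1 = _
    simp [h]
  cases hf with
  | crossing above below l b r x x₀ x₁ x₂ hx hx₀ hx₁ hx₂ =>
    simp only [sub_mul, add_mul, smul_mul_assoc, basis_mul]
    exact .crossing _ _ l b r _ _ _ _ (key hx) (key hx₀) (key hx₁) (key hx₂)
  | deletion_contraction above below l p q r x x₀ x₁ hx hx₀ hx₁ =>
    simp only [sub_mul, smul_mul_assoc, basis_mul]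
    exact .deletion_contraction _ _ l p q r _ _ _ (key hx) (key hx₀) (key hx₁)
  | loop above below l p r x x₀ hx hx₀ =>
    simp only [sub_mul, smul_mul_assoc, basis_mul]
    exact .loop _ _ l p r _ _ (key hx) (key hx₀)
  | circle above below l r x x₀ hx hx₀ =>
    simp only [sub_mul, smul_mul_assoc, basis_mul]
    exact .circle _ _ l r _ _ (key hx) (key hx₀)

theorem mul_mem_yamadaSubmodule {n : ℕ} (a : FreeGraphModule n) {f : FreeGraphModule n}
    (hf : f ∈ yamadaSubmodule n) : a * f ∈ yamadaSubmodule n := by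
  induction a using MonoidAlgebra.induction_on with
  | of g =>
    obtain ⟨y, hy⟩ := exists_basis g
    rw [hy]
    induction hf using Submodule.span_induction with
    | mem f hf => exact Submodule.subset_span (YamadaRelator.basis_mul_left hf y)
    | zero => simp
    | add f g _ _ h₁ h₂ => rw [mul_add]; exact add_mem h₁ h₂
    | smul c f _ h => rw [mul_smul_comm]; exact Submodule.smul_mem _ c h
  | add a b ha hb => rw [add_mul]; exact add_mem ha hb
  | smul c a ha => rw [smul_mul_assoc]; exact Submodule.smul_mem _ c ha

theorem mem_yamadaSubmodule_mul {n : ℕ} (a : FreeGraphModule n) {f : FreeGraphModule n}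
    (hf : f ∈ yamadaSubmodule n) : f * a ∈ yamadaSubmodule n := by
  induction a using MonoidAlgebra.induction_on with
  | of g =>
    obtain ⟨y, hy⟩ := exists_basis g
    rw [hy]
    induction hf using Submodule.span_induction with
    | mem f hf => exact Submodule.subset_span (YamadaRelator.basis_mul_right hf y)
    | zero => simp
    | add f g _ _ h₁ h₂ => rw [add_mul]; exact add_mem h₁ h₂
    | smul c f _ h => rw [smul_mul_assoc]; exact Submodule.smul_mem _ c h
  | add a b ha hb => rw [mul_add]; exact add_mem ha hb
  | smul c a ha => rw [mul_smul_comm]; exact Submodule.smul_mem _ c ha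

/-- The submodule of the Yamada skein relations, regarded as an ideal of the algebra of ribbon
graphs. -/
def yamadaIdeal (n : ℕ) : Ideal (FreeGraphModule n) where
  carrier := yamadaSubmodule n
  add_mem' := (yamadaSubmodule n).add_mem
  zero_mem' := (yamadaSubmodule n).zero_mem
  smul_mem' a _ hf := mul_mem_yamadaSubmodule a hf

instance (n : ℕ) : (yamadaIdeal n).IsTwoSided where
  mul_mem_of_left a hf := mem_yamadaSubmodule_mul a hf

/-- The algebra `𝒴ₙ`: the free module on ribbon `n`-graphs modulo the Yamada skein relations, with
the product given by stacking. -/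
abbrev SkeinAlgebra (n : ℕ) : Type := FreeGraphModule n ⧸ yamadaIdeal n

/-- The class in `𝒴ₙ` of a layered diagram. -/
def skeinClass {n : ℕ} (x : LayeredDiagram n) : SkeinAlgebra n :=
  Ideal.Quotient.mk (yamadaIdeal n) (basis x)

theorem composable_V : Composable 2 [⟨0, .cup, 0⟩, ⟨0, .cap, 0⟩] 2 := ⟨rfl, rfl, rfl⟩

theorem composable_X : Composable 2 [⟨0, .vertex 2 2, 0⟩] 2 := ⟨rfl, rfl⟩

/-- The diagram `V`: one arc joins the two top boundary points and one arc joins the two bottom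
boundary points. -/
def diagramV : LayeredDiagram 2 := ⟨[⟨0, .cup, 0⟩, ⟨0, .cap, 0⟩], composable_V⟩

/-- The diagram `X`: one vertex of valency four joined to the four boundary points. -/
def diagramX : LayeredDiagram 2 := ⟨[⟨0, .vertex 2 2, 0⟩], composable_X⟩

/-- The element `V` of `𝒴₂`. -/
def elementV : SkeinAlgebra 2 := skeinClass diagramV

/-- The element `X` of `𝒴₂`. -/
def elementX : SkeinAlgebra 2 := skeinClass diagramX

/-! ### The commutative algebra -/

/-- The variable `X` of the polynomial algebra in two variables. -/
def varX : MvPolynomial (Fin 2) SkeinRing := MvPolynomial.X 0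

/-- The variable `V` of the polynomial algebra in two variables. -/
def varV : MvPolynomial (Fin 2) SkeinRing := MvPolynomial.X 1

/-- The ideal generated by `V² - (d² - 1)V`, `VX - (d - d⁻¹)V` and `X² - (d - 2d⁻¹)X - d⁻²V`. -/
def relationIdeal : Ideal (MvPolynomial (Fin 2) SkeinRing) :=
  Ideal.span
    {varV ^ 2 - (d ^ 2 - 1) • varV,
      varV * varX - (d - dinv) • varV,
      varX ^ 2 - (d - 2 * dinv) • varX - dinv ^ 2 • varV}

end

end RibbonSkein

/-!
Write `d` for `-A² - A⁻²`. The elements `1`, `X`, `V` form a basis of `𝒴₂`, and they multiply as in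
the presentation; since the three relations reduce every polynomial in `X` and `V` to a combination
of `1`, `X`, `V`, the two algebras agree.

*Independence* needs a representation of `𝒴₂` which separates `1`, `X`, `V`. A `PlanarCalculus` is a
ring of operators in which the uncrossed pieces of diagrams satisfy the planar Yamada relations. In
such a ring a crossing can be defined by the first skein relation, and the extended Reidemeister
moves follow formally from the planar relations: `trivalent_slide` is the essential computation,
and as every vertex is built from trivalent vertices and maxima by contracting edges, it yields
`vertex_slide` and `reidemeister_three`. So every planar calculus represents the skein algebras
(`PlanarCalculus.skeinHom`). If `d² = n` is an integer, nowhere-zero flows with values in `ℤ/n`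
provide one (`Flow.calculus`): the states of an edge are the nonzero elements of `ℤ/n`, and a vertex
imposes Kirchhoff's law with a weight depending on its valency. Deletion-contraction is the usual
recursion for flows. To have all strands act on one module, the state space of a strand is identified
with a summand through a family of operators `push x`, `pop x`, as for the generators of a Cuntz
algebra; this keeps the number of boundary points out of the types. For `n ≥ 4` a few matrix entries
show that `1`, `X`, `V` are independent over the reals. As infinitely many real values of `A` occur,
a relation with coefficients in `ℤ[A^{±1}, d⁻¹]` must be trivial (`skein_independent`).

*Spanning* (`skein_span_eq_top`). Local relations are expressed as equalities `br m n u = br m n w`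
of functions on the ways of completing a slab to a diagram. Bending strands turns a diagram of `𝒴₂`
into one in which all layers lie to the right of two vertical strands and six strands leave at the
bottom (`br_eq_close`). Such a diagram is a combination of creations, i.e. of products of vertices
without upper germs, which picture noncrossing partitions without singletons: adding a layer below a
creation does not leave their span, since a crossing can be smoothed, a vertex can be bent, and a
minimum can be absorbed by the last vertex (`creationSpan_cup`, `creationSpan_layer`). With four
strands besides the two vertical ones, there are three noncrossing partitions without singletons, and
closing up again they become `X`, `1` and `V` (`close_mem`).
-/

namespace RibbonSkein

noncomputable section

/-! ### Planar calculi -/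

/-- A ring of operators on strands in which vertices satisfy the planar Yamada relations. The
product reads pictures from top to bottom, `sh x` is `x` with one more vertical strand on its left,
and `v p q` is a vertex with `p` upper and `q` lower edge germs. The strands to the right of a
picture are not recorded, so that pictures with any number of boundary points live in the same
ring. The parameters `t` and `s` stand for `d` and `d⁻¹`. -/
structure PlanarCalculus {R : Type*} [CommRing R] (t s : R) (E : Type*) [Ring E] [Algebra R E] where
  sh : E →ₐ[R] E
  v : ℕ → ℕ → E
  param : t * s = 1
  v_comm : ∀ p q x, v p q * (sh ^ q) x = (sh ^ p) x * v p q
  bend_left : ∀ p q, sh (v p (q + 1)) * v 2 0 = v (p + 1) q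
  bend_right : ∀ p q, v p (q + 1) * (sh ^ q) (v 2 0) = v (p + 1) q
  v_one_one : v 1 1 = 1
  del_contr : ∀ p q, v p 1 * v 1 q = v p q - s • (v p 0 * v 0 q)
  loop : ∀ p, v p 2 * v 2 0 = (t - s) • v p 0

namespace PlanarCalculus

variable {R : Type*} [CommRing R] {t s : R} {E : Type*} [Ring E] [Algebra R E]
  (c : PlanarCalculus t s E)

theorem sh_pow_succ (q : ℕ) (x : E) : (c.sh ^ (q + 1)) x = (c.sh ^ q) (c.sh x) := by
  rw [pow_succ]; rfl

theorem sh_pow_succ' (q : ℕ) (x : E) : (c.sh ^ (q + 1)) x = c.sh ((c.sh ^ q) x) := by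
  rw [pow_succ']; rfl

theorem sh_pow_add (p q : ℕ) (x : E) : (c.sh ^ (p + q)) x = (c.sh ^ p) ((c.sh ^ q) x) := by
  rw [pow_add]; rfl

theorem sh_pow_zero (x : E) : (c.sh ^ 0) x = x := rfl

theorem snake_left : c.sh (c.v 0 2) * c.v 2 0 = 1 := (c.bend_left 0 1).trans c.v_one_one

theorem snake_right : c.v 0 2 * c.sh (c.v 2 0) = 1 := by
  rw [← c.v_one_one, ← c.bend_right 0 1, pow_one]

/-- Deleting a vertex of valency one kills the diagram: contract the edge `v 1 1`, which is an
ordinary strand, to the vertex `v 2 0`, which is an ordinary arc. -/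
theorem v_zero_one : c.v 0 1 = 0 := by
  have h : c.v 2 0 * c.v 0 1 = 0 := by
    have h := c.del_contr 2 1
    rw [c.v_one_one, mul_one, eq_comm, sub_eq_self] at h
    rw [← one_smul R (c.v 2 0 * c.v 0 1), ← c.param, mul_smul, h, smul_zero]
  rw [← one_mul (c.v 0 1), ← c.snake_left, mul_assoc, h, mul_zero]

theorem v_zero_zero : c.v 0 0 = t • (1 : E) := by
  have h := c.del_contr 0 2
  rw [c.v_zero_one, zero_mul, eq_comm, sub_eq_zero] at h
  calc c.v 0 0 = c.v 0 0 * (c.v 0 2 * c.sh (c.v 2 0)) := by rw [c.snake_right, mul_one]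
    _ = (t * s) • (c.v 0 0 * c.v 0 2 * c.sh (c.v 2 0)) := by rw [c.param, one_smul, mul_assoc]
    _ = t • (1 : E) := by rw [mul_smul, ← smul_mul_assoc, ← h, c.snake_right]

theorem v_one_zero : c.v 1 0 = 0 := by
  rw [← c.bend_left, v_zero_one, map_zero, zero_mul]

theorem unbend_left (p q : ℕ) : c.v 0 2 * c.sh (c.v (p + 1) q) = c.v p (q + 1) := by
  have h := c.v_comm 0 2 (c.v p (q + 1))
  rw [sh_pow_succ', pow_one, sh_pow_zero] at h
  rw [← c.bend_left, map_mul, ← mul_assoc, h, mul_assoc, snake_right, mul_one]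

theorem unbend_right (p q : ℕ) : (c.sh ^ p) (c.v 0 2) * c.v (p + 1) q = c.v p (q + 1) := by
  rw [← c.bend_right, ← mul_assoc, ← c.v_comm, sh_pow_succ, mul_assoc, ← map_mul, snake_left,
    map_one, mul_one]

/-- Contraction of the edge which joins a vertex to a second vertex hanging below any of its lower
germs. -/
theorem contract (p a q b : ℕ) : c.v p (a + 1 + b) * (c.sh ^ a) (c.v 1 q)
    = c.v p (a + q + b) - s • (c.v p (a + b) * (c.sh ^ a) (c.v 0 q)) := by
  induction a generalizing p with
  | zero =>
    induction b generalizing p with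
    | zero => simpa using c.del_contr p q
    | succ b ih =>
      have h := congrArg (fun x => (c.sh ^ p) (c.v 0 2) * x) (ih (p + 1))
      simp only [mul_sub, mul_smul_comm, ← mul_assoc, unbend_right] at h
      exact h
  | succ a ih =>
    have h := congrArg (fun x => c.v 0 2 * c.sh x) (ih (p + 1))
    simp only [map_sub, map_smul, map_mul, mul_sub, mul_smul_comm, ← mul_assoc, unbend_left,
      ← sh_pow_succ'] at h
    rw [show a + 1 + 1 + b = a + 1 + b + 1 by omega, show a + 1 + q + b = a + q + b + 1 by omega,
      h, show a + 1 + b = a + b + 1 by omega]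

theorem loop_at (p a b : ℕ) :
    c.v p (a + 2 + b) * (c.sh ^ a) (c.v 2 0) = (t - s) • c.v p (a + b) := by
  induction a generalizing p with
  | zero =>
    induction b generalizing p with
    | zero => simpa using c.loop p
    | succ b ih =>
      have h := congrArg (fun x => (c.sh ^ p) (c.v 0 2) * x) (ih (p + 1))
      simp only [mul_smul_comm, ← mul_assoc, unbend_right] at h
      exact h
  | succ a ih =>
    have h := congrArg (fun x => c.v 0 2 * c.sh x) (ih (p + 1))
    simp only [map_smul, map_mul, mul_smul_comm, ← mul_assoc, unbend_left, ← sh_pow_succ'] at h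
    rw [show a + 1 + 2 + b = a + 2 + b + 1 by omega, show a + 1 + b = a + b + 1 by omega, h]

/-- The picture of a minimum above a maximum. -/
def hook : E := c.v 2 0 * c.v 0 2

theorem circle : c.v 0 2 * c.v 2 0 = (t ^ 2 - 1) • (1 : E) := by
  rw [c.loop, v_zero_zero, smul_smul, sub_mul, mul_comm s, c.param, sq]

theorem v_two_two_eq : c.v 2 2 = c.sh (c.v 1 3) * c.v 2 0 := (c.bend_left 1 2).symm

theorem v_two_two_eq' : c.v 2 2 = c.v 1 3 * c.sh (c.sh (c.v 2 0)) := by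
  rw [← c.bend_right 1 2, sh_pow_succ, pow_one]

theorem v_two_two_split : c.v 2 2 = c.v 2 1 * c.v 1 2 + s • c.hook := by
  rw [c.del_contr, hook, sub_add_cancel]

/-- A vertex of valency four joined to two neighbouring germs of a vertex. -/
theorem bigon (p a b : ℕ) : c.v p (a + 2 + b) * (c.sh ^ a) (c.v 2 2)
    = (t - 2 * s) • c.v p (a + 2 + b) + s ^ 2 • (c.v p (a + b) * (c.sh ^ a) (c.v 0 2)) := by
  have h₁ := c.contract p (a + 1) 3 b
  have h₂ := c.loop_at p a (2 + b)
  have h₃ := c.contract p a 2 b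
  have h₄ : (c.sh ^ (a + 1)) (c.v 0 3) * (c.sh ^ a) (c.v 2 0) = (c.sh ^ a) (c.v 1 2) := by
    rw [sh_pow_succ, ← map_mul, c.bend_left]
  rw [show a + 1 + 1 + b = a + 2 + b by omega, show a + 1 + 3 + b = a + 2 + (2 + b) by omega] at h₁
  rw [v_two_two_eq, map_mul, ← mul_assoc, ← sh_pow_succ, h₁, sub_mul, smul_mul_assoc, mul_assoc, h₄,
    h₂, h₃, show a + (2 + b) = a + 2 + b by omega]
  module

theorem hook_mul_hook : c.hook * c.hook = (t ^ 2 - 1) • c.hook := by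
  simp only [hook]
  rw [mul_assoc, ← mul_assoc (c.v 0 2), circle, smul_mul_assoc, one_mul, mul_smul_comm]

theorem v_mul_hook : c.v 2 2 * c.hook = (t - s) • c.hook := by
  rw [hook, ← mul_assoc, c.loop, smul_mul_assoc]

theorem hook_mul_v : c.hook * c.v 2 2 = (t - s) • c.hook := by
  have h := c.loop_at 0 0 2
  rw [hook, mul_assoc, v_two_two_eq, ← mul_assoc (c.v 0 2), c.unbend_left]
  rw [sh_pow_zero] at h
  rw [h, mul_smul_comm]

theorem v_mul_v : c.v 2 2 * c.v 2 2 = (t - 2 * s) • c.v 2 2 + s ^ 2 • c.hook := c.bigon 2 0 0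

/-- The ribbon crossing with prescribed coefficients of its two smoothings. -/
def cross (c : PlanarCalculus t s E) (a b : R) : E := a • (1 : E) + b • c.hook - t • c.v 2 2

/-! ### Crossings and Reidemeister moves -/

section Crossing

variable {a b : R}

theorem sh_hook_mul_v : c.sh c.hook * c.v 2 0 = c.sh (c.v 2 0) := by
  rw [hook, map_mul, mul_assoc, snake_left, mul_one]

theorem hook_mul_sh_v : c.hook * c.sh (c.v 2 0) = c.v 2 0 := by
  rw [hook, mul_assoc, snake_right, mul_one]

theorem v_mul_sh_hook : c.v 0 2 * c.sh c.hook = c.sh (c.v 0 2) := by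
  rw [hook, map_mul, ← mul_assoc, snake_right, one_mul]

theorem sh_v_mul_hook : c.sh (c.v 0 2) * c.hook = c.v 0 2 := by
  rw [hook, ← mul_assoc, snake_left, one_mul]

theorem crossing_cup : c.sh (c.cross a b) * c.v 2 0 = c.cross b a * c.sh (c.v 2 0) := by
  have h : c.sh (c.v 2 2) * c.v 2 0 = c.v 2 2 * c.sh (c.v 2 0) := by
    rw [c.bend_left 2 1, ← c.bend_right 2 1, pow_one]
  simp only [cross, map_add, map_sub, map_smul, map_one, add_mul, sub_mul, smul_mul_assoc, one_mul,
    sh_hook_mul_v, hook_mul_sh_v, h]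
  abel

theorem crossing_cap : c.v 0 2 * c.sh (c.cross a b) = c.sh (c.v 0 2) * c.cross b a := by
  have h : c.v 0 2 * c.sh (c.v 2 2) = c.sh (c.v 0 2) * c.v 2 2 := by
    rw [c.unbend_left 1 2, ← c.unbend_right 1 2, pow_one]
  simp only [cross, map_add, map_sub, map_smul, map_one, mul_add, mul_sub, mul_smul_comm, mul_one,
    v_mul_sh_hook, sh_v_mul_hook, h]
  abel

theorem cross_comm (x : E) : c.cross a b * c.sh (c.sh x) = c.sh (c.sh x) * c.cross a b := by
  have h₁ := c.v_comm 2 2 x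
  have h₂ := c.v_comm 2 0 x
  have h₃ := c.v_comm 0 2 x
  simp only [sh_pow_succ, sh_pow_zero] at h₁ h₂ h₃
  simp only [cross, hook, add_mul, sub_mul, mul_add, mul_sub, smul_mul_assoc, mul_smul_comm,
    one_mul, mul_one, h₁]
  rw [mul_assoc, h₃, ← mul_assoc, h₂, mul_assoc]

theorem reidemeister_two (hab : a * b = 1) (hadd : a + b = t ^ 2 - 2) :
    c.cross a b * c.cross b a = 1 := by
  have ht := c.param
  simp only [cross, add_mul, sub_mul, mul_add, mul_sub, smul_mul_assoc, mul_smul_comm, one_mul,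
    mul_one, hook_mul_hook, hook_mul_v, v_mul_hook, v_mul_v]
  obtain rfl : b = t ^ 2 - 2 - a := by linear_combination hadd
  match_scalars
  · linear_combination hab
  · linear_combination (t ^ 2 - 3) * hab + (t ^ 2 - 2) * ht + (t * s + 1) * ht
  · linear_combination -2 * t * ht

theorem sh_v_mul_v : c.sh (c.v 1 2) * c.v 2 2 = c.v 2 3 - s • c.v 1 2 := by
  have h := c.contract 1 0 3 1
  simp only [sh_pow_zero, zero_add, c.v_one_one, one_mul] at h
  rw [v_two_two_eq, ← mul_assoc, ← map_mul, h, map_sub, map_smul, sub_mul, smul_mul_assoc,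
    c.bend_left, c.bend_left]

theorem v_mul_sh_v : c.v 1 2 * c.sh (c.v 2 2) = c.v 2 3 - s • c.sh (c.v 1 2) := by
  have h := c.contract 1 1 3 0
  have h₁ := c.bend_right 1 3
  have h₂ := c.bend_right 0 2
  simp only [sh_pow_succ, sh_pow_zero] at h h₁ h₂
  rw [v_two_two_eq', map_mul, ← mul_assoc]
  simp only [Nat.reduceAdd, add_zero, c.v_one_one, one_mul] at h h₁ h₂
  rw [h, sub_mul, h₁, smul_mul_assoc, ← map_mul, h₂]

/-- A strand slides over a trivalent vertex which splits the strand on its right. -/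
theorem trivalent_slide (hab : a * b = 1) (hadd : a + b = t ^ 2 - 2) :
    c.sh (c.v 1 2) * c.cross a b * c.sh (c.cross a b) = c.cross a b * c.v 1 2 := by
  have ht := c.param
  -- Both sides are expanded into planar diagrams; the next lemmas reduce the products which occur.
  have y₁ : c.sh (c.v 1 2) * c.sh c.hook = 0 := by
    rw [← map_mul, hook, ← mul_assoc, c.loop, v_one_zero, smul_zero, zero_mul, map_zero]
  have y₂ : c.sh (c.v 1 2) * c.sh (c.v 2 2) = (t - 2 * s) • c.sh (c.v 1 2) := by
    have h := c.bigon 1 0 0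
    simp only [sh_pow_zero, zero_add, add_zero, v_one_zero, zero_mul, smul_zero] at h
    rw [← map_mul, h, map_smul]
  have y₃ : c.sh (c.v 1 2) * c.hook = c.v 2 1 * c.v 0 2 := by
    rw [hook, ← mul_assoc, c.bend_left]
  have w₁ : c.v 2 1 * c.v 0 2 * c.sh c.hook = c.v 2 1 * c.sh (c.v 0 2) := by
    rw [mul_assoc, v_mul_sh_hook]
  have w₂ : c.v 2 1 * c.v 0 2 * c.sh (c.v 2 2) = c.v 2 3 - s • (c.v 2 0 * c.v 0 3) := by
    rw [mul_assoc, c.unbend_left 1 2, c.del_contr]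
  have z₁ : c.v 2 3 * c.sh c.hook = (t - s) • (c.v 2 1 * c.sh (c.v 0 2)) := by
    have h := c.loop_at 2 1 0
    simp only [pow_one, Nat.reduceAdd] at h
    rw [hook, map_mul, ← mul_assoc, h, smul_mul_assoc]
  have z₂ : c.v 2 3 * c.sh (c.v 2 2)
      = (t - 2 * s) • c.v 2 3 + s ^ 2 • (c.v 2 1 * c.sh (c.v 0 2)) := by
    simpa using c.bigon 2 1 0
  have v₁ : c.v 1 2 * c.sh c.hook = c.v 2 1 * c.sh (c.v 0 2) := by
    have h := c.bend_right 1 1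
    rw [pow_one] at h
    rw [hook, map_mul, ← mul_assoc, h]
  have u₁ : c.hook * c.v 1 2 = c.v 2 0 * c.v 0 3 := by
    have h := c.contract 0 0 2 1
    simp only [sh_pow_zero, zero_add, v_zero_one, zero_mul, smul_zero, sub_zero] at h
    rw [hook, mul_assoc, h]
  have u₂ : c.v 2 2 * c.v 1 2 = c.v 2 3 - s • (c.v 2 1 * c.v 0 2) := by
    simpa using c.contract 2 0 2 1
  simp only [cross, map_add, map_sub, map_smul, map_one, mul_add, mul_sub, add_mul, sub_mul,
    mul_smul_comm, smul_mul_assoc, mul_one, one_mul, y₁, y₂, y₃, w₁, w₂, z₁, z₂, v₁, u₁, u₂,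
    sh_v_mul_v, v_mul_sh_v, smul_sub, smul_add, smul_zero, smul_smul]
  match_scalars
  · linear_combination a * hadd - hab + 2 * a * ht + (t * s + 1) * ht
  · linear_combination hab - ht
  · linear_combination -t * hadd - 3 * t * ht
  · linear_combination a * ht
  · linear_combination b * hadd - hab + 2 * b * ht + (t * s + 1) * ht
  · linear_combination b * ht

theorem cup_slide (hab : a * b = 1) (hadd : a + b = t ^ 2 - 2) :
    c.cross a b * c.sh (c.cross a b) * c.v 2 0 = c.sh (c.v 2 0) := by
  rw [mul_assoc, crossing_cup, ← mul_assoc, c.reidemeister_two hab hadd, one_mul]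

theorem cap_slide (hab : a * b = 1) (hadd : a + b = t ^ 2 - 2) :
    c.sh (c.v 0 2) * c.cross a b * c.sh (c.cross a b) = c.v 0 2 := by
  rw [← crossing_cap, mul_assoc, ← map_mul,
    c.reidemeister_two ((mul_comm _ _).trans hab) ((add_comm _ _).trans hadd), map_one, mul_one]

/-- A strand slides over a trivalent vertex which merges two strands; the vertex is obtained from
one with two lower germs by bending a germ upwards. -/
theorem trivalent_slide' (hab : a * b = 1) (hadd : a + b = t ^ 2 - 2) :
    c.cross a b * c.sh (c.cross a b) * c.v 2 1 = c.sh (c.v 2 1) * c.cross a b := by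
  have hv : c.v 2 1 = c.sh (c.v 1 2) * c.v 2 0 := (c.bend_left 1 1).symm
  have hc : c.sh (c.sh (c.cross a b)) * c.v 2 0 = c.v 2 0 * c.cross a b :=
    (c.v_comm 2 0 (c.cross a b)).symm
  calc c.cross a b * c.sh (c.cross a b) * c.v 2 1
      = c.cross a b * c.sh (c.cross a b * c.v 1 2) * c.v 2 0 := by
        rw [hv, map_mul]; simp only [mul_assoc]
    _ = c.cross a b * c.sh (c.sh (c.v 1 2)) * c.sh (c.cross a b)
          * (c.sh (c.sh (c.cross a b)) * c.v 2 0) := by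
        rw [← c.trivalent_slide hab hadd, map_mul, map_mul]; simp only [mul_assoc]
    _ = c.sh (c.sh (c.v 1 2)) * (c.cross a b * c.sh (c.cross a b) * c.v 2 0) * c.cross a b := by
        rw [hc, cross_comm]; simp only [mul_assoc]
    _ = c.sh (c.v 2 1) * c.cross a b := by
        rw [c.cup_slide hab hadd, ← map_mul, ← hv]

/-- The third Reidemeister move: expand the crossing over which the third strand passes. -/
theorem reidemeister_three (hab : a * b = 1) (hadd : a + b = t ^ 2 - 2) :
    c.cross a b * c.sh (c.cross a b) * c.cross a b
      = c.sh (c.cross a b) * c.cross a b * c.sh (c.cross a b) := by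
  set x := c.cross a b with hx
  have h₁ : x * c.sh x * c.hook = c.sh c.hook * x * c.sh x := by
    rw [hook, map_mul, ← mul_assoc, c.cup_slide hab hadd, mul_assoc _ _ x, mul_assoc _ (_ * x),
      c.cap_slide hab hadd]
  have h₂ : x * c.sh x * c.v 2 2 = c.sh (c.v 2 2) * x * c.sh x := by
    rw [v_two_two_split, mul_add, mul_smul_comm, h₁, map_add, map_smul, add_mul, add_mul,
      ← mul_assoc, c.trivalent_slide' hab hadd, mul_assoc _ x, ← c.trivalent_slide hab hadd,
      map_mul, smul_mul_assoc, smul_mul_assoc]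
    simp only [mul_assoc, hx]
  have h₃ : ∀ y, y = a • (1 : E) + b • c.hook - t • c.v 2 2 →
      x * c.sh x * y = c.sh y * x * c.sh x := by
    rintro y rfl
    simp only [mul_add, mul_sub, map_add, map_sub, map_smul, map_one, add_mul, sub_mul,
      mul_smul_comm, smul_mul_assoc, h₁, h₂, mul_one, one_mul]
  exact h₃ x rfl

theorem kink_eq (hab : a * b = 1) (hadd : a + b = t ^ 2 - 2) :
    c.sh (c.v 0 2) * c.cross a b * c.sh (c.v 2 0) = a ^ 2 • (1 : E) := by
  have h₁ : c.sh (c.v 0 2) * c.sh (c.v 2 0) = (t ^ 2 - 1) • (1 : E) := by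
    rw [← map_mul, circle, map_smul, map_one]
  have h₂ : c.sh (c.v 0 2) * c.hook * c.sh (c.v 2 0) = 1 := by
    rw [sh_v_mul_hook, snake_right]
  have h₃ : c.sh (c.v 0 2) * c.v 2 2 * c.sh (c.v 2 0) = (t - s) • (1 : E) := by
    have h₄ := c.unbend_right 1 2
    have h₅ := c.loop_at 1 1 0
    simp only [pow_one, Nat.reduceAdd, add_zero, v_one_one] at h₄ h₅
    rw [h₄, h₅]
  have ht := c.param
  simp only [cross, mul_add, mul_sub, add_mul, sub_mul, mul_smul_comm, smul_mul_assoc, mul_one,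
    h₁, h₂, h₃]
  match_scalars
  linear_combination (1 - a) * hadd + hab + ht

theorem reidemeister_one (hab : a * b = 1) (hadd : a + b = t ^ 2 - 2) :
    c.sh (c.v 0 2) * c.cross a b * c.sh (c.v 2 0) *
      (c.sh (c.v 0 2) * c.cross b a * c.sh (c.v 2 0)) = 1 := by
  rw [c.kink_eq hab hadd, c.kink_eq ((mul_comm _ _).trans hab) ((add_comm _ _).trans hadd),
    smul_mul_smul_comm, one_mul, ← mul_pow, hab, one_pow, one_smul]

/-- One strand passes from left to right through the next `q` strands. -/
def pass (c : PlanarCalculus t s E) (a b : R) : ℕ → E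
  | 0 => 1
  | q + 1 => pass c a b q * (c.sh ^ q) (c.cross a b)

theorem pass_comm (q : ℕ) (x : E) :
    c.pass a b q * (c.sh ^ (q + 1)) x = (c.sh ^ (q + 1)) x * c.pass a b q := by
  induction q generalizing x with
  | zero => simp [pass]
  | succ q ih =>
    rw [pass, mul_assoc, sh_pow_succ, sh_pow_succ, ← map_mul, cross_comm, map_mul, ← mul_assoc,
      ← sh_pow_succ, ih, mul_assoc]

/-- A strand slides over a vertex. The vertex is built from trivalent vertices and maxima by
contracting edges, and the strand slides over each of those. -/
theorem vertex_slide (hab : a * b = 1) (hadd : a + b = t ^ 2 - 2) (q : ℕ) :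
    c.sh (c.v 0 q) * c.pass a b q = c.v 0 q := by
  induction q using Nat.twoStepInduction with
  | zero => simp [pass, v_zero_zero]
  | one => simp [v_zero_one]
  | more q ih₀ ih₁ =>
    have key : ∀ k (x y : E), c.sh x * c.cross a b * c.sh (c.cross a b) = y →
        c.sh (c.v 0 k) * ((c.sh ^ (q + 1)) x * c.pass a b (q + 2)) =
          c.sh (c.v 0 k) * c.pass a b q * (c.sh ^ q) y := by
      rintro k x _ rfl
      rw [pass, pass, map_mul, map_mul, ← sh_pow_succ, ← sh_pow_succ]
      simp only [← mul_assoc]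
      rw [mul_assoc (c.sh (c.v 0 k)), ← pass_comm]
      simp only [← mul_assoc]
    have h := c.contract 0 q 2 0
    rw [add_zero, add_zero, add_zero, eq_sub_iff_add_eq] at h
    rw [← h, map_add, map_smul, map_mul, map_mul, add_mul, smul_mul_assoc, mul_assoc, mul_assoc,
      ← sh_pow_succ', ← sh_pow_succ', key _ _ _ (c.trivalent_slide hab hadd),
      key _ _ _ (c.cap_slide hab hadd), ih₀, map_mul, ← mul_assoc, mul_assoc _ (c.pass a b q),
      ← pass, ih₁]

end Crossing
end PlanarCalculus

/-! ### Representations of the skein algebras -/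

theorem smoothingCoeff_mul (b : Bool) : smoothingCoeff b * smoothingCoeff (!b) = 1 := by
  have h : A ^ 4 * Ainv ^ 4 = 1 := by rw [← mul_pow, A_mul_Ainv, one_pow]
  cases b <;> simp [smoothingCoeff, h, mul_comm (Ainv ^ 4)]

theorem smoothingCoeff_add (b : Bool) : smoothingCoeff b + smoothingCoeff (!b) = d ^ 2 - 2 := by
  have h : A ^ 4 + Ainv ^ 4 = d ^ 2 - 2 := by
    rw [d]
    linear_combination (-2 * A * Ainv - 2) * A_mul_Ainv
  cases b <;> simp [smoothingCoeff, h, add_comm (Ainv ^ 4)]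

namespace PlanarCalculus

variable {E : Type*} [Ring E] [Algebra SkeinRing E] (c : PlanarCalculus d dinv E)

/-- The operator of an elementary piece. -/
def piece : Piece → E
  | .cap => c.v 0 2
  | .cup => c.v 2 0
  | .vertex p q => c.v p q
  | .crossing b => c.cross (smoothingCoeff b) (smoothingCoeff (!b))

/-- The operator of a layer; the strands on the right are not recorded. -/
def layer (L : Layer) : E := (c.sh ^ L.left) (c.piece L.piece)

/-- The operator of a stack of layers. -/
def word (w : List Layer) : E := (w.map c.layer).prod

@[simp] theorem word_nil : c.word [] = 1 := rfl

@[simp] theorem word_cons (L : Layer) (w : List Layer) :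
    c.word (L :: w) = c.layer L * c.word w := by simp [word]

@[simp] theorem word_append (u w : List Layer) : c.word (u ++ w) = c.word u * c.word w := by
  simp [word]

theorem piece_comm (g : Piece) (x : E) :
    c.piece g * (c.sh ^ g.bot) x = (c.sh ^ g.top) x * c.piece g := by
  cases g with
  | cap => exact c.v_comm 0 2 x
  | cup => exact c.v_comm 2 0 x
  | vertex p q => exact c.v_comm p q x
  | crossing b => exact c.cross_comm x

theorem word_passRight (l : ℕ) (b : Bool) (q r : ℕ) : c.word (passRight l b q r)
    = (c.sh ^ l) (c.pass (smoothingCoeff b) (smoothingCoeff (!b)) q) := by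
  have h : ∀ k : ℕ → ℕ, c.word ((List.range q).map fun i => ⟨l + i, .crossing b, k i⟩)
      = (c.sh ^ l) (c.pass (smoothingCoeff b) (smoothingCoeff (!b)) q) := by
    intro k
    induction q with
    | zero => simp [pass]
    | succ q ih =>
      rw [List.range_succ, List.map_append, word_append, ih, pass, map_mul, ← sh_pow_add]
      simp [layer, piece]
  exact h _

theorem word_move {u w : List Layer} (h : Move u w) : c.word u = c.word w := by
  have mul (b : Bool) := smoothingCoeff_mul b
  have add (b : Bool) := smoothingCoeff_add b
  have red (l : ℕ) {x y : E} (h : x = y) : (c.sh ^ l) x = (c.sh ^ l) y := by rw [h]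
  cases h with
  | interchange l g m h r =>
    simp only [word_cons, word_nil, layer, mul_one, sh_pow_add, ← map_mul]
    exact red l (c.piece_comm g _)
  | snake_left l r =>
    simpa [layer, piece, sh_pow_succ] using red l c.snake_left
  | snake_right l r =>
    simpa [layer, piece, sh_pow_succ] using red l c.snake_right
  | bend_right l p q r =>
    simpa [layer, piece, sh_pow_add] using red l (c.bend_right p q)
  | bend_left l p q r =>
    simpa [layer, piece, sh_pow_succ] using red l (c.bend_left p q)
  | crossing_cup l b r =>
    simpa [layer, piece, sh_pow_succ] using
      red l (c.crossing_cup (a := smoothingCoeff b) (b := smoothingCoeff (!b)))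
  | crossing_cap l b r =>
    simpa [layer, piece, sh_pow_succ] using
      red l (c.crossing_cap (a := smoothingCoeff b) (b := smoothingCoeff (!b)))
  | two_valent l r => simpa [layer, piece] using red l c.v_one_one
  | reidemeister_one l b r =>
    simpa [layer, piece, sh_pow_succ, kink, mul_assoc] using
      red l (c.reidemeister_one (mul b) (add b))
  | reidemeister_two l b r =>
    simpa [layer, piece] using red l (c.reidemeister_two (mul b) (add b))
  | reidemeister_three l b r =>
    simpa [layer, piece, sh_pow_succ, mul_assoc] using
      red l (c.reidemeister_three (mul b) (add b))
  | vertex_slide l b q r =>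
    simpa [layer, piece, sh_pow_succ, word_passRight] using
      red l (c.vertex_slide (mul b) (add b) q)

/-- Diagrams act through the monoid of ribbon graphs. -/
def graphHom (n : ℕ) : RibbonGraph n →* E :=
  (conGen (Step n)).lift
    { toFun := fun x : LayeredDiagram n => c.word x.1
      map_one' := rfl
      map_mul' := fun x y => c.word_append x.1 y.1 } <| by
    rw [Con.conGen_le]
    rintro x y ⟨above, u, w, below, h, hx, hy⟩
    change c.word x.1 = c.word y.1
    simp [hx, hy, c.word_move h]

/-- The action of linear combinations of ribbon graphs. -/
def freeHom (n : ℕ) : FreeGraphModule n →ₐ[SkeinRing] E :=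
  MonoidAlgebra.lift SkeinRing E (RibbonGraph n) (c.graphHom n)

theorem freeHom_basis {n : ℕ} (x : LayeredDiagram n) : c.freeHom n (basis x) = c.word x.1 := by
  rw [freeHom, basis, MonoidAlgebra.lift_of]
  rfl

theorem freeHom_relator {n : ℕ} {f : FreeGraphModule n} (hf : YamadaRelator n f) :
    c.freeHom n f = 0 := by
  cases hf with
  | crossing above below l b r x x₀ x₁ x₂ hx hx₀ hx₁ hx₂ =>
    rw [map_sub, map_sub, map_add, map_smul, map_smul, map_smul, sub_eq_zero]
    simp only [freeHom_basis, hx, hx₀, hx₁, hx₂, word_append, word_cons, word_nil, layer, piece,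
      cross, hook, mul_one, map_add, map_sub, map_smul, map_one, map_mul, mul_add, mul_sub,
      add_mul, sub_mul, mul_smul_comm, smul_mul_assoc]
  | deletion_contraction above below l p q r x x₀ x₁ hx hx₀ hx₁ =>
    rw [map_sub, map_sub, map_smul, sub_eq_zero]
    simp only [freeHom_basis, hx, hx₀, hx₁, word_append, word_cons, word_nil, layer, piece,
      mul_one, ← map_mul, c.del_contr, map_sub, map_smul, mul_sub, sub_mul, mul_smul_comm,
      smul_mul_assoc]
  | loop above below l p r x x₀ hx hx₀ =>
    rw [map_sub, map_smul, sub_eq_zero]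
    simp only [freeHom_basis, hx, hx₀, word_append, word_cons, word_nil, layer, piece,
      mul_one, ← map_mul, c.loop, map_smul, mul_smul_comm, smul_mul_assoc]
  | circle above below l r x x₀ hx hx₀ =>
    rw [map_sub, map_smul, sub_eq_zero]
    simp only [freeHom_basis, hx, hx₀, word_append, word_cons, word_nil, layer, piece,
      mul_one, ← map_mul, c.circle, map_smul, map_one, mul_smul_comm, smul_mul_assoc]

theorem freeHom_eq_zero {n : ℕ} {f : FreeGraphModule n} (hf : f ∈ yamadaIdeal n) :
    c.freeHom n f = 0 := by
  have h : yamadaSubmodule n ≤ LinearMap.ker (c.freeHom n).toLinearMap :=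
    Submodule.span_le.2 fun f hf => c.freeHom_relator hf
  exact h hf

/-- A planar calculus represents the skein algebras. -/
def skeinHom (n : ℕ) : SkeinAlgebra n →ₐ[SkeinRing] E :=
  Ideal.Quotient.liftₐ (yamadaIdeal n) (c.freeHom n) fun _ => c.freeHom_eq_zero

theorem skeinHom_skeinClass {n : ℕ} (x : LayeredDiagram n) :
    c.skeinHom n (skeinClass x) = c.word x.1 := c.freeHom_basis x

theorem skeinHom_elementX : c.skeinHom 2 elementX = c.v 2 2 :=
  (c.skeinHom_skeinClass _).trans (by simp [diagramX, layer, piece])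

theorem skeinHom_elementV : c.skeinHom 2 elementV = c.hook :=
  (c.skeinHom_skeinClass _).trans (by simp [diagramV, layer, piece, hook])

end PlanarCalculus

/-! ### Cuntz families -/

/-- A Cuntz family: operators `push x` and `pop x`, indexed by the possible states `x` of one
strand, which identify a module with a direct sum of copies of itself. -/
structure CuntzFamily (R E N : Type*) [CommRing R] [Ring E] [Algebra R E] [Fintype N]
    [DecidableEq N] where
  push : N → E
  pop : N → E
  pop_mul_push : ∀ x y, pop x * push y = if x = y then 1 else 0
  sum_push_mul_pop : ∑ x, push x * pop x = 1

namespace CuntzFamily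

variable {R E N : Type*} [CommRing R] [Ring E] [Algebra R E] [Fintype N] [DecidableEq N]
  (f : CuntzFamily R E N)

/-- The shift `x ↦ ∑ y, push y * x * pop y`. -/
def shift : E →ₐ[R] E where
  toFun x := ∑ y, f.push y * x * f.pop y
  map_one' := by simp [f.sum_push_mul_pop]
  map_mul' x y := by
    have h (i j : N) : f.push i * x * f.pop i * (f.push j * y * f.pop j) =
        if i = j then f.push i * (x * y) * f.pop i else 0 := by
      have : f.push i * x * f.pop i * (f.push j * y * f.pop j) =
          f.push i * x * (f.pop i * f.push j) * (y * f.pop j) := by simp only [mul_assoc]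
      rw [this, f.pop_mul_push]
      split_ifs with hij
      · subst hij; simp only [mul_assoc, one_mul]
      · simp
    simp [Finset.sum_mul, Finset.mul_sum, h]
  map_zero' := by simp
  map_add' x y := by simp [mul_add, add_mul, Finset.sum_add_distrib]
  commutes' r := by
    simp only [← Algebra.commutes, mul_assoc, ← Finset.mul_sum, f.sum_push_mul_pop, mul_one]

theorem shift_apply (x : E) : f.shift x = ∑ y, f.push y * x * f.pop y := rfl

theorem pop_mul_shift (y : N) (x : E) : f.pop y * f.shift x = x * f.pop y := by
  simp [shift_apply, Finset.mul_sum, ← mul_assoc, f.pop_mul_push, ite_mul]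

theorem shift_mul_push (x : E) (y : N) : f.shift x * f.push y = f.push y * x := by
  simp [shift_apply, Finset.sum_mul, mul_assoc, f.pop_mul_push]

end CuntzFamily

/-! ### Nowhere-zero flows -/

namespace Flow

/-- The states of an edge: the nonzero elements of a finite abelian group. -/
abbrev State (G : Type*) [Zero G] : Type _ := {x : G // x ≠ 0}

variable {R E G : Type*} [CommRing R] [Ring E] [Algebra R E] [AddCommGroup G] [Fintype G]
  [DecidableEq G] (f : CuntzFamily R E (State G)) (t s : R)

/-- The sum over all states of `q` strands with total flow `g`, which removes these states. -/
def emit : ℕ → G → E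
  | 0, g => if g = 0 then 1 else 0
  | q + 1, g => ∑ x : State G, emit q (g - x) * f.pop x

/-- A vertex at which the total flow entering from above, increased by `g`, equals the total flow
leaving below. The weight `t * s ^ p` is `d ^ (1 - p)`; it is `d ^ (1 - (p + q) / 2)`, made rational
by a factor `d ^ (1 / 2)` for each lower and `d ^ (-1 / 2)` for each upper boundary point. -/
def vertex : ℕ → ℕ → G → E
  | 0, q, g => t • emit f q g
  | p + 1, q, g => s • ∑ x : State G, f.push x * vertex p q (g + x)

theorem vertex_zero (q : ℕ) (g : G) : vertex f t s 0 q g = t • emit f q g := rfl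

theorem vertex_succ (p q : ℕ) (g : G) :
    vertex f t s (p + 1) q g = s • ∑ x : State G, f.push x * vertex f t s p q (g + x) := rfl

theorem emit_succ (q : ℕ) (g : G) :
    emit f (q + 1) g = ∑ x : State G, emit f q (g - x) * f.pop x := rfl

theorem emit_comm (q : ℕ) (g : G) (x : E) :
    emit f q g * (f.shift ^ q) x = x * emit f q g := by
  induction q generalizing g with
  | zero => by_cases h : g = 0 <;> simp [emit, h]
  | succ q ih =>
    have h : (f.shift ^ (q + 1)) x = f.shift ((f.shift ^ q) x) := by rw [pow_succ']; rfl
    simp only [emit, Finset.sum_mul, Finset.mul_sum, mul_assoc, h, f.pop_mul_shift]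
    simp only [← mul_assoc, ih]

theorem vertex_comm (p q : ℕ) (g : G) (x : E) :
    vertex f t s p q g * (f.shift ^ q) x = (f.shift ^ p) x * vertex f t s p q g := by
  induction p generalizing g with
  | zero => rw [vertex, smul_mul_assoc, emit_comm, mul_smul_comm, pow_zero, AlgHom.one_apply]
  | succ p ih =>
    have h : (f.shift ^ (p + 1)) x = f.shift ((f.shift ^ p) x) := by rw [pow_succ']; rfl
    simp only [vertex, smul_mul_assoc, mul_smul_comm, Finset.sum_mul, Finset.mul_sum, mul_assoc,
      ih, h]
    simp only [← mul_assoc, f.shift_mul_push]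

theorem emit_mul_push (q : ℕ) (g : G) (x : State G) :
    emit f (q + 1) g * f.push x = emit f q (g - x) := by
  simp [emit, Finset.sum_mul, mul_assoc, f.pop_mul_push]

theorem vertex_mul_push (p q : ℕ) (g : G) (x : State G) :
    vertex f t s p (q + 1) g * f.push x = vertex f t s p q (g - x) := by
  induction p generalizing g with
  | zero => simp [vertex, emit_mul_push]
  | succ p ih =>
    simp only [vertex, smul_mul_assoc, Finset.sum_mul, mul_assoc, ih, add_sub_right_comm]

variable {t s}

/-- The inverse of a state. -/
def neg (x : State G) : State G := ⟨-x, neg_ne_zero.2 x.2⟩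

theorem sum_ite_eq_val (g : G) (F : State G → E) :
    (∑ x : State G, if g = x then F x else 0) = if h : g ≠ 0 then F ⟨g, h⟩ else 0 := by
  split_ifs with h
  · rw [Finset.sum_eq_single ⟨g, h⟩]
    · simp
    · rintro ⟨b, hb⟩ _ hbg
      rw [if_neg]
      rintro rfl
      exact hbg rfl
    · simp
  · refine Finset.sum_eq_zero fun x _ => if_neg ?_
    rintro rfl
    exact h x.2

theorem cup_eq (hts : t * s = 1) : vertex f t s 2 0 0 = s • ∑ x, f.push x * f.push (neg x) := by
  have h : ∀ x : State G, (∑ y : State G, f.push y * vertex f t s 0 0 (0 + x.1 + y.1)) =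
      t • f.push (neg x) := by
    intro x
    rw [Finset.sum_eq_single (neg x)]
    · simp [vertex, emit, neg]
    · rintro y - hy
      rw [vertex, emit, if_neg, smul_zero, mul_zero]
      intro h
      apply hy
      ext
      rw [zero_add] at h
      exact (neg_eq_of_add_eq_zero_right h).symm
    · simp
  simp only [vertex] at h ⊢
  simp only [h, smul_smul, mul_comm s t, hts, one_smul]

theorem pop_mul_cup (hts : t * s = 1) (x : State G) :
    f.pop x * vertex f t s 2 0 0 = s • f.push (neg x) := by
  simp [cup_eq f hts, Finset.mul_sum, ← mul_assoc, f.pop_mul_push, ite_mul]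

theorem vertex_bend_left (hts : t * s = 1) (p q : ℕ) (g : G) :
    f.shift (vertex f t s p (q + 1) g) * vertex f t s 2 0 0 = vertex f t s (p + 1) q g := by
  rw [vertex_succ f t s p, CuntzFamily.shift_apply]
  simp only [Finset.sum_mul, mul_assoc, pop_mul_cup f hts, mul_smul_comm, vertex_mul_push,
    ← Finset.smul_sum]
  simp [neg]

theorem emit_bend_right (hts : t * s = 1) (q : ℕ) (g : G) :
    emit f (q + 1) g * (f.shift ^ q) (vertex f t s 2 0 0) =
      s • ∑ x : State G, f.push x * emit f q (g + x) := by
  induction q generalizing g with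
  | zero =>
    simp only [emit, Finset.sum_mul, pow_zero, AlgHom.one_apply, mul_assoc, pop_mul_cup f hts,
      mul_smul_comm, Finset.smul_sum]
    refine Fintype.sum_equiv ⟨neg, neg, fun x => by simp [neg], fun x => by simp [neg]⟩ _ _ ?_
    intro x
    by_cases h : g - x = 0 <;> simp [neg, h, ← sub_eq_add_neg]
  | succ q ih =>
    have h : (f.shift ^ (q + 1)) (vertex f t s 2 0 0) =
      f.shift ((f.shift ^ q) (vertex f t s 2 0 0)) := by rw [pow_succ']; rfl
    rw [emit, Finset.sum_mul]
    simp only [mul_assoc, h, f.pop_mul_shift]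
    simp only [← mul_assoc, ih, smul_mul_assoc, Finset.sum_mul]
    rw [← Finset.smul_sum, Finset.sum_comm]
    simp only [emit, Finset.mul_sum, mul_assoc, sub_add_eq_add_sub]

theorem vertex_bend_right (hts : t * s = 1) (p q : ℕ) (g : G) :
    vertex f t s p (q + 1) g * (f.shift ^ q) (vertex f t s 2 0 0) = vertex f t s (p + 1) q g := by
  induction p generalizing g with
  | zero =>
    rw [vertex, smul_mul_assoc, emit_bend_right f hts]
    simp only [vertex, mul_smul_comm, Finset.smul_sum, smul_comm t s]
  | succ p ih =>
    rw [vertex, smul_mul_assoc, Finset.sum_mul]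
    simp only [mul_assoc, ih]
    rfl

theorem vertex_one_one (hts : t * s = 1) : vertex f t s 1 1 0 = 1 := by
  have h : ∀ x : State G, vertex f t s 0 1 (0 + x.1) = t • f.pop x := by
    intro x
    rw [vertex, emit, zero_add, Finset.sum_eq_single x]
    · simp [emit]
    · intro y _ hy
      rw [emit, if_neg, zero_mul]
      exact fun h => hy (Subtype.ext (sub_eq_zero.1 h).symm)
    · simp
  rw [vertex]
  simp only [h, mul_smul_comm, ← Finset.smul_sum, f.sum_push_mul_pop, smul_smul, mul_comm s t, hts,
    one_smul]

theorem vertex_del_contr (hts : t * s = 1) (p q : ℕ) (g : G) :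
    vertex f t s p 1 g * vertex f t s 1 q 0 =
      vertex f t s p q g - s • (vertex f t s p 0 g * vertex f t s 0 q 0) := by
  induction p generalizing g with
  | zero =>
    have h₁ : ∀ x : State G, f.pop x * vertex f t s 1 q 0 = emit f q x := by
      intro x
      simp [vertex, Finset.mul_sum, ← mul_assoc, f.pop_mul_push, ite_mul, smul_smul, mul_comm s t,
        hts]
    have h₂ : emit f 1 g * vertex f t s 1 q 0 = if g ≠ 0 then emit f q g else 0 := by
      simp only [emit, Finset.sum_mul, h₁, ite_mul, one_mul, zero_mul, sub_eq_zero,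
        sum_ite_eq_val g fun x : State G => emit f q (x : G), dite_eq_ite]
    rw [vertex, smul_mul_assoc, h₂]
    by_cases h : g = 0 <;> simp [vertex, emit, h, smul_smul, hts, mul_comm s t, ← mul_assoc]
  | succ p ih =>
    simp only [vertex_succ f t s p, smul_mul_assoc, Finset.sum_mul, mul_assoc, ih, mul_sub,
      Finset.sum_sub_distrib, smul_sub, mul_smul_comm, ← Finset.smul_sum]

theorem vertex_loop (hts : t * s = 1)
    (hG : (Fintype.card G : E) = algebraMap R E (t ^ 2)) (p : ℕ) (g : G) :
    vertex f t s p 2 g * vertex f t s 2 0 0 = (t - s) • vertex f t s p 0 g := by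
  induction p generalizing g with
  | zero =>
    have hN : ((Fintype.card (State G) : ℕ) : E) = algebraMap R E (t ^ 2 - 1) := by
      have h : Fintype.card (State G) + 1 = Fintype.card G := by
        have h := Fintype.card_subtype_compl (fun x : G => x = 0)
        rw [Fintype.card_subtype_eq] at h
        have := Fintype.card_pos_iff.2 (⟨0⟩ : Nonempty G)
        change Fintype.card {x : G // ¬ x = 0} + 1 = _
        omega
      rw [map_sub, ← hG, ← h, map_one]
      push_cast
      abel
    have h : emit f 2 g * vertex f t s 2 0 0 = (t - s) • emit f 0 g := by
      have h : ∀ x : State G, emit f 1 (g - x) * f.pop x * vertex f t s 2 0 0 =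
          s • emit f 0 g := by
        intro x
        rw [mul_assoc, pop_mul_cup f hts, mul_smul_comm, emit_mul_push]
        simp [neg]
      rw [emit_succ, Finset.sum_mul]
      simp only [h, Finset.sum_const, Finset.card_univ]
      rw [← Nat.cast_smul_eq_nsmul E, hN, algebraMap_smul, smul_smul]
      congr 1
      linear_combination t * hts
    rw [vertex_zero, vertex_zero, smul_mul_assoc, h, smul_comm]
  | succ p ih =>
    simp only [vertex_succ f t s p, smul_mul_assoc, Finset.sum_mul, mul_assoc, ih, mul_smul_comm,
      ← Finset.smul_sum]
    rw [smul_comm]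

/-- The planar calculus of nowhere-zero flows with values in a group of order `d ^ 2`. -/
def calculus (hts : t * s = 1) (hG : (Fintype.card G : E) = algebraMap R E (t ^ 2)) :
    PlanarCalculus t s E where
  sh := f.shift
  v p q := vertex f t s p q 0
  param := hts
  v_comm p q x := vertex_comm f t s p q 0 x
  bend_left p q := vertex_bend_left f hts p q 0
  bend_right p q := vertex_bend_right f hts p q 0
  v_one_one := vertex_one_one f hts
  del_contr p q := vertex_del_contr f hts p q 0
  loop p := vertex_loop f hts hG p 0

end Flow

/-! ### Matrix entries of the flow model -/

namespace Flow

section MatrixEntries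

variable {R E G : Type*} [CommRing R] [Ring E] [Algebra R E] [AddCommGroup G] [Fintype G]
  [DecidableEq G] (f : CuntzFamily R E (State G)) {t s : R}

theorem pop_mul_vertex (p q : ℕ) (g : G) (x : State G) :
    f.pop x * vertex f t s (p + 1) q g = s • vertex f t s p q (g + x) := by
  simp [vertex_succ, Finset.mul_sum, ← mul_assoc, f.pop_mul_push, ite_mul]

theorem entry_one (x y z w : State G) : f.pop y * f.pop x * (f.push z * f.push w) =
    if x = z ∧ y = w then 1 else 0 := by
  rw [mul_assoc, ← mul_assoc (f.pop x), f.pop_mul_push]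
  by_cases h : x = z <;> simp [h, f.pop_mul_push]

theorem entry_vertex (hts : t * s = 1) (x y z w : State G) :
    f.pop y * f.pop x * vertex f t s 2 2 0 * (f.push z * f.push w) =
      if (x : G) + y = z + w then s • (1 : E) else 0 := by
  have h : ((0 : G) + x + y - z - w = 0) ↔ (x : G) + y = z + w := by
    rw [sub_sub, sub_eq_zero, zero_add]
  rw [mul_assoc (f.pop y), pop_mul_vertex, mul_smul_comm, pop_mul_vertex, smul_mul_assoc,
    smul_mul_assoc, ← mul_assoc, vertex_mul_push, vertex_mul_push, vertex, emit, smul_smul,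
    smul_smul]
  simp only [h]
  split_ifs
  · congr 1
    linear_combination s * hts
  · rw [smul_zero]

theorem entry_hook (hts : t * s = 1) (x y z w : State G) :
    f.pop y * f.pop x * (vertex f t s 2 0 0 * vertex f t s 0 2 0) * (f.push z * f.push w) =
      if (x : G) + y = 0 ∧ (z : G) + w = 0 then 1 else 0 := by
  have h₁ : f.pop y * f.pop x * vertex f t s 2 0 0 =
      if (x : G) + y = 0 then s • (1 : E) else 0 := by
    rw [mul_assoc, pop_mul_vertex, mul_smul_comm, pop_mul_vertex, vertex, emit, zero_add, smul_smul,
      smul_smul]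
    split_ifs
    · congr 1
      linear_combination s * hts
    · rw [smul_zero]
  have h₂ : vertex f t s 0 2 0 * (f.push z * f.push w) =
      if (z : G) + w = 0 then t • (1 : E) else 0 := by
    have h : ((0 : G) - z - w = 0) ↔ (z : G) + w = 0 := by
      rw [sub_sub, zero_sub, neg_eq_zero]
    rw [← mul_assoc, vertex_mul_push, vertex_mul_push, vertex, emit]
    simp only [h]
    split_ifs <;> simp
  rw [← mul_assoc (f.pop y * f.pop x), h₁, mul_assoc, h₂]
  by_cases hx : (x : G) + y = 0 <;> by_cases hz : (z : G) + w = 0 <;>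
    simp [hx, hz, smul_smul, hts]

/-- With at least four group elements, the identity, the vertex of valency four and the hook are
linearly independent. -/
theorem calculus_independent {n : ℕ} (hn : 4 ≤ n) [NeZero n]
    (f : CuntzFamily R E (State (ZMod n))) (hts : t * s = 1)
    (hG : (Fintype.card (ZMod n) : E) = algebraMap R E (t ^ 2)) {a b c : R}
    (h : a • (1 : E) + b • (calculus f hts hG).v 2 2 + c • (calculus f hts hG).hook = 0) :
    a • (1 : E) = 0 ∧ b • (1 : E) = 0 ∧ c • (1 : E) = 0 := by
  have hne : ∀ k : ℕ, 0 < k → k < 4 → (k : ZMod n) ≠ 0 := fun k hk hk4 hk0 => by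
    have := Nat.le_of_dvd hk ((ZMod.natCast_eq_zero_iff k n).1 hk0)
    omega
  have h₁ : (1 : ZMod n) ≠ 0 := by simpa using hne 1 (by norm_num) (by norm_num)
  have h₂ : (2 : ZMod n) ≠ 0 := by simpa using hne 2 (by norm_num) (by norm_num)
  have h₃ : (3 : ZMod n) ≠ 0 := by simpa using hne 3 (by norm_num) (by norm_num)
  have h₁₁ : (1 : ZMod n) + 1 ≠ 0 := by rwa [one_add_one_eq_two]
  have h₁₃ : (1 : ZMod n) ≠ 3 := fun h => h₂ (by linear_combination -h)
  have key : ∀ x y z w : State (ZMod n),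
      a • (if x = z ∧ y = w then (1 : E) else 0) +
        b • (if (x : ZMod n) + y = z + w then s • (1 : E) else 0) +
        c • (if (x : ZMod n) + y = 0 ∧ (z : ZMod n) + w = 0 then (1 : E) else 0) = 0 := by
    intro x y z w
    have h' := congrArg (fun m => f.pop y * f.pop x * m * (f.push z * f.push w)) h
    simp only [mul_add, add_mul, mul_smul_comm, smul_mul_assoc, mul_one, mul_zero, zero_mul] at h'
    rw [entry_one] at h'
    erw [entry_vertex f hts, entry_hook f hts] at h'
    exact h'
  -- States in which only the vertex of valency four has a nonzero matrix entry.
  have hb' := key ⟨1, h₁⟩ ⟨1, h₁⟩ ⟨3, h₃⟩ ⟨-1, neg_ne_zero.2 h₁⟩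
  have e : (1 : ZMod n) + 1 = 3 + -1 := by norm_num
  simp only [Subtype.mk.injEq, h₁₃, false_and, if_false, e, if_true, smul_zero, zero_add] at hb'
  rw [if_neg (fun h' => h₁₁ (e.trans h'.1)), smul_zero, add_zero, smul_comm] at hb'
  have hb : b • (1 : E) = 0 := by
    rw [← one_smul R (b • (1 : E)), ← hts, mul_smul, hb', smul_zero]
  -- The hook does not contribute, since `1 + 1 ≠ 0`.
  have ha := key ⟨1, h₁⟩ ⟨1, h₁⟩ ⟨1, h₁⟩ ⟨1, h₁⟩
  simp only [and_self, if_true, h₁₁, if_false, smul_zero, add_zero, smul_comm b s, hb] at ha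
  -- All three contribute here, and `a` and `b` are already known to act by zero.
  have hc := key ⟨1, h₁⟩ ⟨-1, neg_ne_zero.2 h₁⟩ ⟨1, h₁⟩ ⟨-1, neg_ne_zero.2 h₁⟩
  simp only [and_self, if_true, smul_zero, add_zero, smul_comm b s, hb, ha, zero_add,
    add_neg_cancel] at hc
  exact ⟨ha, hb, hc⟩

end MatrixEntries

/-- The Cuntz family on functions of infinitely many strand states. -/
def streamFamily (R K N : Type*) [CommRing R] [CommRing K] [Algebra R K] [Fintype N]
    [DecidableEq N] : CuntzFamily R (Module.End R (Stream' N → K)) N where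
  push x :=
    { toFun := fun F u => if u.head = x then F u.tail else 0
      map_add' := fun F F' => by ext u; by_cases h : u.head = x <;> simp [h]
      map_smul' := fun r F => by ext u; by_cases h : u.head = x <;> simp [h] }
  pop x :=
    { toFun := fun F u => F (Stream'.cons x u)
      map_add' := fun _ _ => rfl
      map_smul' := fun _ _ => rfl }
  pop_mul_push x y := by
    ext F u
    by_cases h : x = y <;> simp [h]
  sum_push_mul_pop := by
    ext F u
    simp [LinearMap.sum_apply, Finset.sum_apply, Stream'.eta]

end Flow

/-! ### Real values of the parameter -/

/-- The homomorphism `ℤ[A^{±1}] → ℝ` which evaluates at a nonzero real number. -/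
def laurentEval (u : ℝˣ) : LaurentPolynomial ℤ →+* ℝ :=
  LaurentPolynomial.eval₂ (Int.castRingHom ℝ) u

theorem laurentEval_dLaurent (u : ℝˣ) :
    laurentEval u dLaurent = -((u : ℝ) ^ 2 + (u : ℝ)⁻¹ ^ 2) := by
  have h₁ := LaurentPolynomial.eval₂_T_n (Int.castRingHom ℝ) u 2
  have h₂ := LaurentPolynomial.eval₂_T_neg_n (Int.castRingHom ℝ) u 2
  simp only [Nat.cast_ofNat] at h₁ h₂
  rw [laurentEval, dLaurent, map_sub, map_neg, h₁, h₂]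
  simp
  ring

theorem isUnit_laurentEval_dLaurent (u : ℝˣ) : IsUnit (laurentEval u dLaurent) := by
  rw [laurentEval_dLaurent, isUnit_iff_ne_zero, neg_ne_zero]
  have := u.ne_zero
  positivity

/-- The homomorphism `ℤ[A^{±1}, d⁻¹] → ℝ` which evaluates at a nonzero real number. -/
def skeinEval (u : ℝˣ) : SkeinRing →+* ℝ :=
  IsLocalization.Away.lift dLaurent (isUnit_laurentEval_dLaurent u)

theorem skeinEval_algebraMap (u : ℝˣ) (p : LaurentPolynomial ℤ) :
    skeinEval u (algebraMap _ SkeinRing p) = laurentEval u p :=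
  IsLocalization.Away.lift_eq dLaurent (isUnit_laurentEval_dLaurent u) p

theorem d_eq : d = algebraMap (LaurentPolynomial ℤ) SkeinRing dLaurent := by
  simp only [d, A, Ainv, dLaurent, map_sub, map_neg, ← map_pow, LaurentPolynomial.T_pow]
  norm_num

theorem skeinEval_d (u : ℝˣ) : skeinEval u d = -((u : ℝ) ^ 2 + (u : ℝ)⁻¹ ^ 2) := by
  rw [d_eq, skeinEval_algebraMap, laurentEval_dLaurent]

/-- An element of `ℤ[A^{±1}, d⁻¹]` which vanishes at infinitely many real numbers is zero: up to
powers of `d` and `A` it is a polynomial. -/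
theorem eq_zero_of_skeinEval {S : Set ℝˣ} (hS : S.Infinite) {r : SkeinRing}
    (hr : ∀ u ∈ S, skeinEval u r = 0) : r = 0 := by
  obtain ⟨n, p, hp⟩ := IsLocalization.Away.surj dLaurent r
  obtain ⟨m, f, hf⟩ := p.exists_T_pow
  have hroot : ∀ u ∈ S, Polynomial.IsRoot (f.map (Int.castRingHom ℝ)) (u : ℝ) := by
    intro u hu
    have h₁ : laurentEval u p = 0 := by
      rw [← skeinEval_algebraMap, ← hp, map_mul, hr u hu, zero_mul]
    have h₂ := congrArg (laurentEval u) hf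
    rw [map_mul, h₁, zero_mul, laurentEval, LaurentPolynomial.eval₂_toLaurent] at h₂
    rwa [Polynomial.IsRoot, Polynomial.eval_map]
  have hf0 : f.map (Int.castRingHom ℝ) = 0 := by
    refine Polynomial.eq_zero_of_infinite_isRoot _ ?_
    refine (hS.image (Units.val_injective.injOn)).mono ?_
    rintro _ ⟨u, hu, rfl⟩
    exact hroot u hu
  have hf1 : f = 0 := (Polynomial.map_eq_zero_iff Int.cast_injective).1 hf0
  have hp0 : p = 0 := by
    rw [hf1, map_zero, eq_comm] at hf
    have hT : (LaurentPolynomial.T (m : ℤ) : LaurentPolynomial ℤ) * .T (-(m : ℤ)) = 1 := by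
      rw [← LaurentPolynomial.T_add, add_neg_cancel, LaurentPolynomial.T_zero]
    rw [← mul_one p, ← hT, ← mul_assoc, hf, zero_mul]
  rw [hp0, map_zero] at hp
  have hd : d * dinv = 1 := d_mul_dinv
  rw [← d_eq] at hp
  calc r = r * d ^ n * dinv ^ n := by rw [mul_assoc, ← mul_pow, hd, one_pow, mul_one]
    _ = 0 := by rw [hp, zero_mul]

/-- The value of `A` is a square root of `r`, where `r + r⁻¹ = √n`; a real solution `r` exists as
`n ≥ 4`. -/
theorem exists_skeinEval_d_sq (n : ℕ) (hn : 4 ≤ n) :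
    ∃ u : ℝˣ, skeinEval u d ^ 2 = n := by
  have hn' : (4 : ℝ) ≤ n := by exact_mod_cast hn
  set r : ℝ := (√n + √(n - 4)) / 2 with hr
  have h₁ : √(n : ℝ) ^ 2 = n := Real.sq_sqrt (by linarith)
  have h₂ : √((n : ℝ) - 4) ^ 2 = n - 4 := Real.sq_sqrt (by linarith)
  have hpos : 0 < r := by
    have : 0 < √(n : ℝ) := Real.sqrt_pos.2 (by linarith)
    have := Real.sqrt_nonneg ((n : ℝ) - 4)
    positivity
  have hinv : r⁻¹ = √n - r := by
    refine inv_eq_of_mul_eq_one_right ?_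
    rw [hr]
    linear_combination (h₁ - h₂) / 4
  refine ⟨Units.mk0 (√r) (Real.sqrt_pos.2 hpos).ne', ?_⟩
  rw [skeinEval_d, Units.val_mk0, inv_pow, Real.sq_sqrt hpos.le, hinv, neg_sq]
  rwa [add_sub_cancel]

/-- In the skein algebra of two strands, `1`, `X` and `V` are linearly independent: for every
integer `n ≥ 4`, the values of `A` with `d² = n` give a state model in which they are. -/
theorem skein_independent {a b c : SkeinRing}
    (h : a • (1 : SkeinAlgebra 2) + b • elementX + c • elementV = 0) : a = 0 ∧ b = 0 ∧ c = 0 := by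
  choose u hu using exists_skeinEval_d_sq
  have hinf : (Set.range fun n : Set.Ici 4 => u n.1 n.2).Infinite := by
    have : Infinite (Set.Ici 4) := (Set.Ici_infinite 4).to_subtype
    refine Set.infinite_range_of_injective fun n m hnm => ?_
    have h := hu n.1 n.2
    rw [show u n.1 n.2 = u m.1 m.2 from hnm, hu m.1 m.2] at h
    exact Subtype.ext (by exact_mod_cast h.symm)
  have key : ∀ n : Set.Ici 4, skeinEval (u n.1 n.2) a = 0 ∧ skeinEval (u n.1 n.2) b = 0 ∧
      skeinEval (u n.1 n.2) c = 0 := by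
    rintro ⟨n, hn : 4 ≤ n⟩
    let _ : Algebra SkeinRing ℝ := (skeinEval (u n hn)).toAlgebra
    have : NeZero n := ⟨by omega⟩
    let f := Flow.streamFamily SkeinRing ℝ (Flow.State (ZMod n))
    have hG : (Fintype.card (ZMod n) :
        Module.End SkeinRing (Stream' (Flow.State (ZMod n)) → ℝ)) = algebraMap SkeinRing _ (d ^ 2) := by
      ext F x
      rw [Module.algebraMap_end_apply, ZMod.card, Pi.smul_apply, Algebra.smul_def, map_pow,
        RingHom.algebraMap_toAlgebra, hu n hn]
      simp [Module.End.natCast_apply]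
    have hE := congrArg ((Flow.calculus f d_mul_dinv hG).skeinHom 2) h
    simp only [map_add, map_smul, map_one, map_zero, PlanarCalculus.skeinHom_elementX,
      PlanarCalculus.skeinHom_elementV] at hE
    have hv : ∀ r : SkeinRing,
        r • (1 : Module.End SkeinRing (Stream' (Flow.State (ZMod n)) → ℝ)) = 0 →
          skeinEval (u n hn) r = 0 := by
      intro r hr
      have : Fact (1 < n) := ⟨by omega⟩
      have h := congrFun (congrArg (fun m => m fun _ => (1 : ℝ)) hr)
        (Stream'.const ⟨1, one_ne_zero⟩)
      simpa [Algebra.smul_def, RingHom.algebraMap_toAlgebra] using h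
    obtain ⟨h₁, h₂, h₃⟩ := Flow.calculus_independent hn f d_mul_dinv hG hE
    exact ⟨hv _ h₁, hv _ h₂, hv _ h₃⟩
  have fin : ∀ r : SkeinRing, (∀ n : Set.Ici 4, skeinEval (u n.1 n.2) r = 0) → r = 0 := by
    intro r hr
    refine eq_zero_of_skeinEval hinf ?_
    rintro _ ⟨n, rfl⟩
    exact hr n
  exact ⟨fin a fun n => (key n).1, fin b fun n => (key n).2.1, fin c fun n => (key n).2.2⟩

/-! ### Diagrams in context -/

open Classical in
/-- The class of a stack of layers in the skein algebra of two strands; it is zero if the layers do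
not fit together. -/
def cls (w : List Layer) : SkeinAlgebra 2 :=
  if h : Composable 2 w 2 then skeinClass ⟨w, h⟩ else 0

theorem cls_eq {w : List Layer} (h : Composable 2 w 2) : cls w = skeinClass ⟨w, h⟩ := dif_pos h

/-- Functions on the ways of completing a diagram with `m` upper and `n` lower boundary points to a
diagram of the skein algebra of two strands. -/
abbrev Ctx (m n : ℕ) : Type :=
  {a : List Layer // Composable 2 a m} → {b : List Layer // Composable n b 2} → SkeinAlgebra 2

/-- A diagram with `m` upper and `n` lower boundary points, regarded as the function which completes
it. Equalities between linear combinations of such functions are the relations which hold locally,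
in a slab of any diagram. -/
def br (m n : ℕ) (w : List Layer) : Ctx m n := fun a b => cls (a.1 ++ w ++ b.1)

/-- Stacking a diagram on top. -/
def pre {k m : ℕ} (n : ℕ) (x : List Layer) (hx : Composable k x m := by
      simp only [Composable, Layer.top, Layer.bot, Piece.top, Piece.bot, true_and, and_true]
      <;> omega) :
    Ctx m n →ₗ[SkeinRing] Ctx k n where
  toFun F a b := F ⟨a.1 ++ x, a.2.append hx⟩ b
  map_add' _ _ := rfl
  map_smul' _ _ := rfl

/-- Stacking a diagram below. -/
def post (m : ℕ) {n k : ℕ} (y : List Layer) (hy : Composable n y k := by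
      simp only [Composable, Layer.top, Layer.bot, Piece.top, Piece.bot, true_and, and_true]
      <;> omega) :
    Ctx m n →ₗ[SkeinRing] Ctx m k where
  toFun F a b := F a ⟨y ++ b.1, hy.append b.2⟩
  map_add' _ _ := rfl
  map_smul' _ _ := rfl

theorem pre_br {k m : ℕ} (n : ℕ) (x : List Layer) (hx : Composable k x m) (w : List Layer) :
    pre n x hx (br m n w) = br k n (x ++ w) := by
  ext a b
  simp [pre, br]

theorem post_br (m : ℕ) {n k : ℕ} (y : List Layer) (hy : Composable n y k) (w : List Layer) :
    post m y hy (br m n w) = br m k (w ++ y) := by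
  ext a b
  simp [post, br]

theorem skeinClass_eq_of_relator {x : LayeredDiagram 2} {f : FreeGraphModule 2}
    (h : YamadaRelator 2 (basis x - f)) : skeinClass x = Ideal.Quotient.mk (yamadaIdeal 2) f :=
  Ideal.Quotient.eq.2 (Submodule.subset_span h)

theorem toGraph_eq_of_move {n : ℕ} {x y : LayeredDiagram n} {a u w b : List Layer} (h : Move u w)
    (hx : x.1 = a ++ u ++ b) (hy : y.1 = a ++ w ++ b) : toGraph x = toGraph y :=
  (Con.eq _).2 (ConGen.Rel.of _ _ ⟨a, u, w, b, h, hx, hy⟩)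

/-- A move inside a stack of layers does not change its class. -/
theorem br_step {m n : ℕ} (x : List Layer) {u w : List Layer} (y : List Layer) (h : Move u w)
    (hu : Composable m (x ++ u ++ y) n := by
      simp only [Composable, Layer.top, Layer.bot, Piece.top, Piece.bot, List.cons_append,
        List.nil_append, true_and, and_true] <;> omega)
    (hw : Composable m (x ++ w ++ y) n := by
      simp only [Composable, Layer.top, Layer.bot, Piece.top, Piece.bot, List.cons_append,
        List.nil_append, true_and, and_true] <;> omega) :
    br m n (x ++ u ++ y) = br m n (x ++ w ++ y) := by
  ext a b
  rw [br, br, cls_eq ((a.2.append hu).append b.2), cls_eq ((a.2.append hw).append b.2)]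
  exact congrArg (fun g => Ideal.Quotient.mk (yamadaIdeal 2)
    (MonoidAlgebra.of SkeinRing (RibbonGraph 2) g))
    (toGraph_eq_of_move (a := a.1 ++ x) (b := y ++ b.1) h (by simp) (by simp))

/-- The interchange move with the numbers of neighbouring strands given up to equations. -/
theorem Move.interchange_of {l r r₁ r₂ l₁ l₂ : ℕ} {g h : Piece} (m : ℕ)
    (hr₁ : r₁ = m + h.top + r := by simp only [Piece.top, Piece.bot] <;> omega)
    (hl₂ : l₂ = l + g.bot + m := by simp only [Piece.top, Piece.bot] <;> omega)
    (hl₁ : l₁ = l + g.top + m := by simp only [Piece.top, Piece.bot] <;> omega)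
    (hr₂ : r₂ = m + h.bot + r := by simp only [Piece.top, Piece.bot] <;> omega) :
    Move [⟨l, g, r₁⟩, ⟨l₂, h, r⟩] [⟨l₁, h, r⟩, ⟨l, g, r₂⟩] := by
  subst hr₁ hl₂ hl₁ hr₂
  exact .interchange l g m h r

theorem br_crossing (l : ℕ) (b : Bool) (r : ℕ) {m n : ℕ} (hm : m = l + 2 + r)
    (hn : n = l + 2 + r) :
    br m n [⟨l, .crossing b, r⟩] = smoothingCoeff b • br m n []
      + smoothingCoeff (!b) • br m n [⟨l, .cup, r⟩, ⟨l, .cap, r⟩]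
      - d • br m n [⟨l, .vertex 2 2, r⟩] := by
  subst hm hn
  ext x y
  have h₀ : Composable (l + 2 + r) [] (l + 2 + r) := rfl
  have h₁ : Composable (l + 2 + r) [⟨l, .cup, r⟩, ⟨l, .cap, r⟩] (l + 2 + r) := ⟨rfl, rfl, rfl⟩
  have h₂ : Composable (l + 2 + r) [⟨l, .vertex 2 2, r⟩] (l + 2 + r) := ⟨rfl, rfl⟩
  have h₃ : Composable (l + 2 + r) [⟨l, .crossing b, r⟩] (l + 2 + r) := ⟨rfl, rfl⟩
  simp only [br, Pi.sub_apply, Pi.add_apply, Pi.smul_apply]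
  rw [cls_eq ((x.2.append h₀).append y.2), cls_eq ((x.2.append h₁).append y.2),
    cls_eq ((x.2.append h₂).append y.2), cls_eq ((x.2.append h₃).append y.2)]
  exact skeinClass_eq_of_relator (.crossing x.1 y.1 l b r _ _ _ _ rfl rfl rfl rfl)

theorem br_del_contr (l p q r : ℕ) {m n : ℕ} (hm : m = l + p + r) (hn : n = l + q + r) :
    br m n [⟨l, .vertex p 1, r⟩, ⟨l, .vertex 1 q, r⟩] = br m n [⟨l, .vertex p q, r⟩]
      - dinv • br m n [⟨l, .vertex p 0, r⟩, ⟨l, .vertex 0 q, r⟩] := by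
  subst hm hn
  ext x y
  have h₀ : Composable (l + p + r) [⟨l, .vertex p q, r⟩] (l + q + r) := ⟨rfl, rfl⟩
  have h₁ : Composable (l + p + r) [⟨l, .vertex p 0, r⟩, ⟨l, .vertex 0 q, r⟩] (l + q + r) :=
    ⟨rfl, rfl, rfl⟩
  have h₂ : Composable (l + p + r) [⟨l, .vertex p 1, r⟩, ⟨l, .vertex 1 q, r⟩] (l + q + r) :=
    ⟨rfl, rfl, rfl⟩
  simp only [br, Pi.sub_apply, Pi.smul_apply]
  rw [cls_eq ((x.2.append h₀).append y.2), cls_eq ((x.2.append h₁).append y.2),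
    cls_eq ((x.2.append h₂).append y.2)]
  exact skeinClass_eq_of_relator (.deletion_contraction x.1 y.1 l p q r _ _ _ rfl rfl rfl)

theorem br_loop (l p r : ℕ) {m n : ℕ} (hm : m = l + p + r) (hn : n = l + r) :
    br m n [⟨l, .vertex p 2, r⟩, ⟨l, .cup, r⟩] = (d - dinv) • br m n [⟨l, .vertex p 0, r⟩] := by
  subst hm hn
  ext x y
  have h₀ : Composable (l + p + r) [⟨l, .vertex p 0, r⟩] (l + r) := ⟨rfl, rfl⟩
  have h₁ : Composable (l + p + r) [⟨l, .vertex p 2, r⟩, ⟨l, .cup, r⟩] (l + r) := ⟨rfl, rfl, rfl⟩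
  simp only [br, Pi.smul_apply]
  rw [cls_eq ((x.2.append h₀).append y.2), cls_eq ((x.2.append h₁).append y.2)]
  exact skeinClass_eq_of_relator (.loop x.1 y.1 l p r _ _ rfl rfl)

theorem br_circle (l r : ℕ) {m n : ℕ} (hm : m = l + r) (hn : n = l + r) :
    br m n [⟨l, .cap, r⟩, ⟨l, .cup, r⟩] = (d ^ 2 - 1) • br m n [] := by
  subst hm hn
  ext x y
  have h₀ : Composable (l + r) [] (l + r) := rfl
  have h₁ : Composable (l + r) [⟨l, .cap, r⟩, ⟨l, .cup, r⟩] (l + r) := ⟨rfl, rfl, rfl⟩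
  simp only [br, Pi.smul_apply]
  rw [cls_eq ((x.2.append h₀).append y.2), cls_eq ((x.2.append h₁).append y.2)]
  exact skeinClass_eq_of_relator (.circle x.1 y.1 l r _ _ rfl rfl)

/-! ### Local relations -/

theorem br_cap (l r : ℕ) {m n : ℕ} (hm : m = l + r) (hn : n = l + 2 + r) :
    br m n [⟨l, .cap, r⟩] = br m n [⟨l, .vertex 0 2, r⟩] := by
  calc br m n [⟨l, .cap, r⟩]
      = br m n [⟨l, .cap, r⟩, ⟨l, .vertex 1 1, r + 1⟩] :=
        (br_step [⟨l, .cap, r⟩] [] (.two_valent l (r + 1))).symm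
    _ = br m n [⟨l, .cap, r⟩, ⟨l, .vertex 0 2, r + 2⟩, ⟨l + 1, .cup, r + 1⟩] :=
        (br_step [⟨l, .cap, r⟩] [] (.bend_right l 0 1 (r + 1))).symm
    _ = br m n [⟨l, .vertex 0 2, r⟩, ⟨l + 2, .cap, r⟩, ⟨l + 1, .cup, r + 1⟩] :=
        (br_step [] [⟨l + 1, .cup, r + 1⟩] (.interchange_of 0)).symm
    _ = br m n [⟨l, .vertex 0 2, r⟩] :=
        br_step [⟨l, .vertex 0 2, r⟩] [] (.snake_left (l + 1) r)

theorem br_cup (l r : ℕ) {m n : ℕ} (hm : m = l + 2 + r) (hn : n = l + r) :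
    br m n [⟨l, .cup, r⟩] = br m n [⟨l, .vertex 2 0, r⟩] := by
  calc br m n [⟨l, .cup, r⟩]
      = br m n [⟨l, .vertex 1 1, r + 1⟩, ⟨l, .cup, r⟩] :=
        (br_step [] [⟨l, .cup, r⟩] (.two_valent l (r + 1))).symm
    _ = br m n [⟨l, .vertex 2 0, r⟩] := br_step [] [] (.bend_right l 1 0 r)

theorem br_unbend_left (l p q r : ℕ) {m n k : ℕ} (hm : m = l + p + r) (hn : n = l + (q + 1) + r)
    (hk : k = p + r) :
    br m n [⟨l, .cap, k⟩, ⟨l + 1, .vertex (p + 1) q, r⟩] = br m n [⟨l, .vertex p (q + 1), r⟩] := by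
  calc br m n [⟨l, .cap, k⟩, ⟨l + 1, .vertex (p + 1) q, r⟩]
      = br m n [⟨l, .cap, k⟩, ⟨l + 2, .vertex p (q + 1), r⟩, ⟨l + 1, .cup, q + r⟩] :=
        (br_step [⟨l, .cap, k⟩] [] (.bend_left (l + 1) p q r)).symm
    _ = br m n [⟨l, .vertex p (q + 1), r⟩, ⟨l, .cap, q + r + 1⟩, ⟨l + 1, .cup, q + r⟩] :=
        br_step [] [⟨l + 1, .cup, q + r⟩] (.interchange_of 0)
    _ = br m n [⟨l, .vertex p (q + 1), r⟩] :=
        br_step [⟨l, .vertex p (q + 1), r⟩] [] (.snake_right l (q + r))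

theorem br_unbend_right (l p q r : ℕ) {m n : ℕ} (hm : m = l + p + r) (hn : n = l + (q + 1) + r) :
    br m n [⟨l + p, .cap, r⟩, ⟨l, .vertex (p + 1) q, r + 1⟩]
      = br m n [⟨l, .vertex p (q + 1), r⟩] := by
  calc br m n [⟨l + p, .cap, r⟩, ⟨l, .vertex (p + 1) q, r + 1⟩]
      = br m n [⟨l + p, .cap, r⟩, ⟨l, .vertex p (q + 1), r + 2⟩, ⟨l + q, .cup, r + 1⟩] :=
        (br_step [⟨l + p, .cap, r⟩] [] (.bend_right l p q (r + 1))).symm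
    _ = br m n [⟨l, .vertex p (q + 1), r⟩, ⟨l + q + 1, .cap, r⟩, ⟨l + q, .cup, r + 1⟩] :=
        (br_step [] [⟨l + q, .cup, r + 1⟩] (.interchange_of 0)).symm
    _ = br m n [⟨l, .vertex p (q + 1), r⟩] :=
        br_step [⟨l, .vertex p (q + 1), r⟩] [] (.snake_left (l + q) r)

/-- Next to a strand, a vertex of valency one kills the diagram. -/
theorem br_vertex_zero_one (l r : ℕ) {m n : ℕ} (hm : m = l + 1 + r) (hn : n = l + 2 + r) :
    br m n [⟨l + 1, .vertex 0 1, r⟩] = 0 := by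
  have h₁ : br (l + 3 + r) n [⟨l + 1, .vertex 2 0, r⟩, ⟨l + 1, .vertex 0 1, r⟩] = 0 := by
    have h := br_del_contr (l + 1) 2 1 r (m := l + 3 + r) (n := n) (by omega) (by omega)
    have h' : br (l + 3 + r) n [⟨l + 1, .vertex 2 1, r⟩, ⟨l + 1, .vertex 1 1, r⟩]
        = br (l + 3 + r) n [⟨l + 1, .vertex 2 1, r⟩] :=
      br_step [⟨l + 1, .vertex 2 1, r⟩] [] (.two_valent (l + 1) r)
    rw [h', eq_comm, sub_eq_self] at h
    rw [← one_smul SkeinRing (br _ _ _), ← d_mul_dinv, mul_smul, h, smul_zero]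
  have h₂ : br (l + 3 + r) (l + 1 + r) [⟨l + 1, .cup, r⟩]
      = br (l + 3 + r) (l + 1 + r) [⟨l + 1, .vertex 2 0, r⟩] := br_cup _ _ (by omega) rfl
  have h₃ := congrArg (post _ (k := n) [⟨l + 1, .vertex 0 1, r⟩]) h₂
  have h₄ := congrArg (pre (k := m) n [⟨l, .cap, r + 1⟩]) h₃
  simp only [post_br, pre_br, List.cons_append, List.nil_append, h₁, map_zero] at h₄
  rw [← h₄]
  exact (br_step [] [⟨l + 1, .vertex 0 1, r⟩] (.snake_right l r)).symm

/-- Next to a strand, an isolated vertex contributes a factor `d`. -/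
theorem br_vertex_zero_zero (l r : ℕ) {m n : ℕ} (hm : m = l + 1 + r) (hn : n = l + 1 + r) :
    br m n [⟨l + 1, .vertex 0 0, r⟩] = d • br m n [] := by
  have h := br_del_contr (l + 1) 0 2 r (m := m) (n := l + 3 + r) (by omega) (by omega)
  have hy : Composable (l + 2 + r) [⟨l + 1, .vertex 1 2, r⟩] (l + 3 + r) := by
    constructor <;> simp only [Composable, Layer.top, Layer.bot, Piece.top, Piece.bot]
  have h₁ : br m (l + 3 + r) ([⟨l + 1, .vertex 0 1, r⟩] ++ [⟨l + 1, .vertex 1 2, r⟩]) = 0 := by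
    rw [← post_br m _ hy, br_vertex_zero_one l r hm rfl, map_zero]
  have h₂ := congrArg (pre (k := m) (l + 3 + r) [⟨l + 1, .vertex 0 0, r⟩])
    (br_cap (l + 1) r hm (by omega))
  rw [List.cons_append, List.nil_append] at h₁
  rw [pre_br, pre_br, List.cons_append, List.nil_append, List.cons_append, List.nil_append] at h₂
  rw [h₁, ← h₂, eq_comm, sub_eq_zero, ← br_cap (l + 1) r (by omega) (by omega)] at h
  have h₃ := congrArg (post m (k := n) [⟨l, .cup, r + 1⟩]) h
  rw [map_smul, post_br, post_br] at h₃
  have h₄ : br m n [⟨l + 1, .cap, r⟩, ⟨l, .cup, r + 1⟩] = br m n [] :=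
    br_step [] [] (.snake_left l r)
  have h₅ : br m n [⟨l + 1, .vertex 0 0, r⟩, ⟨l + 1, .cap, r⟩, ⟨l, .cup, r + 1⟩]
      = br m n [⟨l + 1, .vertex 0 0, r⟩] := br_step [⟨l + 1, .vertex 0 0, r⟩] [] (.snake_left l r)
  simp only [List.cons_append, List.nil_append] at h₃
  rw [← h₄, h₃, h₅, smul_smul, d_mul_dinv, one_smul]

theorem br_unbend_left_append (l p q r : ℕ) (y : List Layer) {m n k : ℕ} (hm : m = l + p + r)
    (hk : k = p + r) (hy : Composable (l + (q + 1) + r) y n) :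
    br m n ([⟨l, .cap, k⟩, ⟨l + 1, .vertex (p + 1) q, r⟩] ++ y)
      = br m n ([⟨l, .vertex p (q + 1), r⟩] ++ y) := by
  rw [← post_br m y hy, ← post_br m y hy, br_unbend_left l p q r hm rfl hk]

theorem br_unbend_right_append (l p q r : ℕ) (y : List Layer) {m n : ℕ} (hm : m = l + p + r)
    (hy : Composable (l + (q + 1) + r) y n) :
    br m n ([⟨l + p, .cap, r⟩, ⟨l, .vertex (p + 1) q, r + 1⟩] ++ y)
      = br m n ([⟨l, .vertex p (q + 1), r⟩] ++ y) := by
  rw [← post_br m y hy, ← post_br m y hy, br_unbend_right l p q r hm rfl]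

/-- Contraction of the edge which joins a vertex to a second vertex hanging below any of its lower
germs. -/
theorem br_contract (l p a q b r : ℕ) {m n k j : ℕ} (hm : m = l + p + r)
    (hn : n = l + (a + q + b) + r) (hk : k = b + r) (hj : j = l + a) :
    br m n [⟨l, .vertex p (a + 1 + b), r⟩, ⟨j, .vertex 1 q, k⟩]
      = br m n [⟨l, .vertex p (a + q + b), r⟩]
        - dinv • br m n [⟨l, .vertex p (a + b), r⟩, ⟨j, .vertex 0 q, k⟩] := by
  subst hk hj
  induction a generalizing l p m with
  | zero =>
    induction b generalizing p r m with
    | zero => simpa using br_del_contr l p q r hm (by omega)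
    | succ b ih =>
      have h := congrArg (pre (k := m) n [⟨l + p, .cap, r⟩])
        (ih (p := p + 1) (r := r + 1) (m := l + p + 2 + r) (by omega) (by omega))
      rw [map_sub, map_smul, pre_br, pre_br, pre_br] at h
      have c₁ := br_unbend_right_append l p (0 + 1 + b) r [⟨l + 0, .vertex 1 q, b + (r + 1)⟩]
        (n := n) hm (by simp only [Composable, Layer.top, Layer.bot, Piece.top, Piece.bot]; omega)
      have c₂ := br_unbend_right_append l p (0 + b) r [⟨l + 0, .vertex 0 q, b + (r + 1)⟩]
        (n := n) hm (by simp only [Composable, Layer.top, Layer.bot, Piece.top, Piece.bot]; omega)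
      have c₃ := br_unbend_right l p (0 + q + b) r (n := n) hm (by omega)
      simp only [List.cons_append, List.nil_append] at h c₁ c₂ c₃
      rw [c₁, c₂, c₃, show b + (r + 1) = b + 1 + r by omega] at h
      exact h
  | succ a ih =>
    have h := congrArg (pre (k := m) n [⟨l, .cap, p + r⟩])
      (ih (l + 1) (p + 1) (m := l + p + 2 + r) (by omega) (by omega))
    rw [map_sub, map_smul, pre_br, pre_br, pre_br] at h
    have c₁ := br_unbend_left_append l p (a + 1 + b) r [⟨l + 1 + a, .vertex 1 q, b + r⟩]
      (n := n) hm rfl (by simp only [Composable, Layer.top, Layer.bot, Piece.top, Piece.bot]; omega)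
    have c₂ := br_unbend_left_append l p (a + b) r [⟨l + 1 + a, .vertex 0 q, b + r⟩]
      (n := n) hm rfl (by simp only [Composable, Layer.top, Layer.bot, Piece.top, Piece.bot]; omega)
    have c₃ := br_unbend_left l p (a + q + b) r (n := n) hm (by omega) rfl
    simp only [List.cons_append, List.nil_append] at h c₁ c₂ c₃
    rw [c₁, c₂, c₃] at h
    rw [show a + 1 + 1 + b = a + 1 + b + 1 by omega, show a + 1 + q + b = a + q + b + 1 by omega,
      show l + (a + 1) = l + 1 + a by omega, h, show a + 1 + b = a + b + 1 by omega]

theorem br_loop_at (l p a b r : ℕ) {m n k j : ℕ} (hm : m = l + p + r)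
    (hn : n = l + (a + b) + r) (hk : k = b + r) (hj : j = l + a) :
    br m n [⟨l, .vertex p (a + 2 + b), r⟩, ⟨j, .cup, k⟩]
      = (d - dinv) • br m n [⟨l, .vertex p (a + b), r⟩] := by
  subst hk hj
  induction a generalizing l p m with
  | zero =>
    induction b generalizing p r m with
    | zero => simpa using br_loop l p r hm (by omega)
    | succ b ih =>
      have h := congrArg (pre (k := m) n [⟨l + p, .cap, r⟩])
        (ih (p := p + 1) (r := r + 1) (m := l + p + 2 + r) (by omega) (by omega))
      rw [map_smul, pre_br, pre_br] at h
      have c₁ := br_unbend_right_append l p (0 + 2 + b) r [⟨l + 0, .cup, b + (r + 1)⟩]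
        (n := n) hm (by simp only [Composable, Layer.top, Layer.bot, Piece.top, Piece.bot]; omega)
      have c₂ := br_unbend_right l p (0 + b) r (n := n) hm (by omega)
      simp only [List.cons_append, List.nil_append] at h c₁ c₂
      rw [c₁, c₂, show b + (r + 1) = b + 1 + r by omega] at h
      exact h
  | succ a ih =>
    have h := congrArg (pre (k := m) n [⟨l, .cap, p + r⟩])
      (ih (l + 1) (p + 1) (m := l + p + 2 + r) (by omega) (by omega))
    rw [map_smul, pre_br, pre_br] at h
    have c₁ := br_unbend_left_append l p (a + 2 + b) r [⟨l + 1 + a, .cup, b + r⟩]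
      (n := n) hm rfl (by simp only [Composable, Layer.top, Layer.bot, Piece.top, Piece.bot]; omega)
    have c₂ := br_unbend_left l p (a + b) r (n := n) hm (by omega) rfl
    simp only [List.cons_append, List.nil_append] at h c₁ c₂
    rw [c₁, c₂] at h
    rw [show a + 1 + 2 + b = a + 2 + b + 1 by omega, show l + (a + 1) = l + 1 + a by omega, h,
      show a + 1 + b = a + b + 1 by omega]

/-! ### Spanning by creations -/

/-- `Creation n w`: below two vertical strands on the left, the layers of `w` create vertices without
upper germs and of valency at least two, and `n` strands leave at the bottom. These diagrams
correspond to the noncrossing partitions without singletons. -/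
inductive Creation : ℕ → List Layer → Prop
  | nil : Creation 2 []
  | snoc {w : List Layer} (l q r : ℕ) (hw : Creation (l + 2 + r) w) :
      Creation (l + 2 + (q + 2) + r) (w ++ [⟨l + 2, .vertex 0 (q + 2), r⟩])

theorem Creation.composable {n : ℕ} {w : List Layer} (h : Creation n w) : Composable 2 w n := by
  induction h with
  | nil => rfl
  | snoc l q r _ ih => exact ih.append ⟨rfl, rfl⟩

/-- The combinations of creations. -/
def creationSpan (n : ℕ) : Submodule SkeinRing (Ctx 2 n) :=
  Submodule.span SkeinRing {F | ∃ w, Creation n w ∧ br 2 n w = F}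

theorem Creation.mem {n : ℕ} {w : List Layer} (h : Creation n w) : br 2 n w ∈ creationSpan n :=
  Submodule.subset_span ⟨w, h, rfl⟩

theorem map_mem_of_creation {n : ℕ} {M : Type*} [AddCommGroup M] [Module SkeinRing M]
    {S : Submodule SkeinRing M} {f : Ctx 2 n →ₗ[SkeinRing] M}
    (h : ∀ w, Creation n w → f (br 2 n w) ∈ S) {F : Ctx 2 n} (hF : F ∈ creationSpan n) :
    f F ∈ S := by
  have : creationSpan n ≤ S.comap f := Submodule.span_le.2 (by rintro _ ⟨w, hw, rfl⟩; exact h w hw)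
  exact this hF

/-- Local relations may be applied at the end of a stack of layers. -/
theorem br_append {m k n : ℕ} {w u u' : List Layer} (hw : Composable m w k)
    (h : br k n u = br k n u') : br m n (w ++ u) = br m n (w ++ u') := by
  rw [← pre_br n w hw, h, pre_br]

theorem creationSpan_post {n k : ℕ} (L : Layer) (hn : L.top = n) (hk : L.bot = k)
    (h : ∀ w, Creation n w → br 2 k (w ++ [L]) ∈ creationSpan k) {w : List Layer}
    (hw : br 2 n w ∈ creationSpan n) : br 2 k (w ++ [L]) ∈ creationSpan k := by
  have hy : Composable n [L] k := ⟨hn, hk⟩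
  rw [← post_br 2 [L] hy]
  refine map_mem_of_creation (fun w hw => ?_) hw
  rw [post_br]
  exact h w hw

/-- Adding a vertex without upper germs: valency at least two gives a creation by definition, and
smaller valencies contribute a factor `0` or `d`. -/
theorem creationSpan_vertex (l q r : ℕ) {n k : ℕ} (hn : n = l + 2 + r) (hk : k = l + 2 + q + r)
    {w : List Layer} (hw : br 2 n w ∈ creationSpan n) :
    br 2 k (w ++ [⟨l + 2, .vertex 0 q, r⟩]) ∈ creationSpan k := by
  subst hn hk
  refine creationSpan_post (n := l + 2 + r) (k := l + 2 + q + r) ⟨l + 2, .vertex 0 q, r⟩ rfl rfl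
    (fun w hw => ?_) hw
  match q with
  | 0 =>
    have h : br (l + 2 + r) (l + 2 + 0 + r) [⟨l + 2, .vertex 0 0, r⟩]
        = d • br (l + 2 + r) (l + 2 + 0 + r) [] :=
      br_vertex_zero_zero (l + 1) r rfl rfl
    rw [← pre_br _ w hw.composable, h, map_smul, pre_br, List.append_nil]
    exact Submodule.smul_mem _ _ hw.mem
  | 1 =>
    have h : br (l + 2 + r) (l + 2 + 1 + r) [⟨l + 2, .vertex 0 1, r⟩] = 0 :=
      br_vertex_zero_one (l + 1) r (by omega) (by omega)
    rw [← pre_br _ w hw.composable, h, map_zero]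
    exact Submodule.zero_mem _
  | q + 2 => exact (Creation.snoc l q r hw).mem

/-- The span of creations is closed under vertices with one upper germ: such a vertex is joined by
an edge to the last created vertex, and the edge is contracted, or it is moved above that vertex. -/
theorem Creation.vertex_one_mem {n : ℕ} {w : List Layer} (hw : Creation n w) :
    ∀ (l q r k : ℕ), n = l + 3 + r → k = l + 2 + q + r →
      br 2 k (w ++ [⟨l + 2, .vertex 1 q, r⟩]) ∈ creationSpan k := by
  induction hw with
  | nil => intro l q r k h; omega
  | @snoc w l' q' r' hw ih =>
    intro l q r k hn hk
    rw [List.append_assoc, List.cons_append, List.nil_append]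
    by_cases h₁ : l < l'
    · obtain ⟨m, rfl⟩ : ∃ m, l' = l + 1 + m := ⟨l' - l - 1, by omega⟩
      have h : br (l + 1 + m + 2 + r') k [⟨l + 2, .vertex 1 q, m + r'⟩,
            ⟨l + q + m + 2, .vertex 0 (q' + 2), r'⟩]
          = br (l + 1 + m + 2 + r') k [⟨l + 1 + m + 2, .vertex 0 (q' + 2), r'⟩,
            ⟨l + 2, .vertex 1 q, r⟩] := br_step [] [] (.interchange_of m)
      rw [br_append hw.composable h.symm, ← List.singleton_append, ← List.append_assoc]
      exact creationSpan_vertex (l + q + m) (q' + 2) r' rfl (by omega)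
        (ih l q (m + r') _ (by omega) (by omega))
    by_cases h₂ : l < l' + q' + 2
    · obtain ⟨a, rfl⟩ : ∃ a, l = l' + a := ⟨l - l', by omega⟩
      obtain ⟨b, hb⟩ : ∃ b, q' + 2 = a + 1 + b := ⟨q' + 1 - a, by omega⟩
      have hr : r = b + r' := by omega
      have hF := hw.mem
      rw [hb, ← pre_br _ w hw.composable,
        br_contract (l' + 2) 0 a q b r' rfl (by omega) hr (by omega), map_sub, map_smul, pre_br,
        pre_br, ← List.singleton_append (l := [_]), ← List.append_assoc]
      refine Submodule.sub_mem _ (creationSpan_vertex _ _ _ rfl (by omega) hF)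
        (Submodule.smul_mem _ _ ?_)
      exact creationSpan_vertex (l' + a) q r (by omega) hk
        (creationSpan_vertex l' (a + b) r' rfl rfl hF)
    · obtain ⟨m, rfl⟩ : ∃ m, l = l' + q' + 2 + m := ⟨l - l' - q' - 2, by omega⟩
      have h : br (l' + 2 + r') k [⟨l' + 2, .vertex 0 (q' + 2), r'⟩,
            ⟨l' + q' + 2 + m + 2, .vertex 1 q, r⟩]
          = br (l' + 2 + r') k [⟨l' + m + 2, .vertex 1 q, r⟩,
            ⟨l' + 2, .vertex 0 (q' + 2), m + q + r⟩] := br_step [] [] (.interchange_of m)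
      rw [br_append hw.composable h, ← List.singleton_append, ← List.append_assoc]
      exact creationSpan_vertex l' (q' + 2) (m + q + r) rfl (by omega)
        (ih (l' + m) q r _ (by omega) (by omega))

/-- The span of creations is closed under minima: a minimum forms a loop with two germs of the last
created vertex, or bends one of its germs upwards, or is moved above that vertex. -/
theorem Creation.cup_mem {n : ℕ} {w : List Layer} (hw : Creation n w) :
    ∀ (l r k : ℕ), n = l + 4 + r → k = l + 2 + r →
      br 2 k (w ++ [⟨l + 2, .cup, r⟩]) ∈ creationSpan k := by
  induction hw with
  | nil => intro l r k h; omega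
  | @snoc w l' q' r' hw ih =>
    intro l r k hn hk
    rw [List.append_assoc, List.cons_append, List.nil_append]
    by_cases h₁ : l + 1 < l'
    · obtain ⟨m, rfl⟩ : ∃ m, l' = l + 2 + m := ⟨l' - l - 2, by omega⟩
      have h : br (l + 2 + m + 2 + r') k [⟨l + 2, .cup, m + r'⟩,
            ⟨l + m + 2, .vertex 0 (q' + 2), r'⟩]
          = br (l + 2 + m + 2 + r') k [⟨l + 2 + m + 2, .vertex 0 (q' + 2), r'⟩,
            ⟨l + 2, .cup, r⟩] := br_step [] [] (.interchange_of m)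
      rw [br_append hw.composable h.symm, ← List.singleton_append, ← List.append_assoc]
      exact creationSpan_vertex (l + m) (q' + 2) r' rfl (by omega)
        (ih l (m + r') _ (by omega) (by omega))
    by_cases h₂ : l + 1 = l'
    · obtain rfl : r = q' + 1 + r' := by omega
      subst h₂
      have h : br (l + 1 + 2 + r') k [⟨l + 2 + 1, .vertex 0 (q' + 2), r'⟩,
            ⟨l + 2, .cup, q' + 1 + r'⟩]
          = br (l + 1 + 2 + r') k [⟨l + 2, .vertex 1 (q' + 1), r'⟩] :=
        br_step [] [] (.bend_left (l + 2) 0 (q' + 1) r')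
      rw [show l + 1 + 2 = l + 2 + 1 by omega] at *
      rw [br_append hw.composable h]
      exact hw.vertex_one_mem _ _ _ _ (by omega) (by omega)
    by_cases h₃ : l ≤ l' + q'
    · obtain ⟨a, rfl⟩ : ∃ a, l = l' + a := ⟨l - l', by omega⟩
      obtain ⟨b, rfl⟩ : ∃ b, q' = a + b := ⟨q' - a, by omega⟩
      rw [show a + b + 2 = a + 2 + b by omega, ← pre_br _ w hw.composable,
        br_loop_at (l' + 2) 0 a b r' rfl (by omega) (by omega) (by omega), map_smul, pre_br]
      exact Submodule.smul_mem _ _ (creationSpan_vertex _ _ _ rfl (by omega) hw.mem)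
    by_cases h₄ : l = l' + q' + 1
    · obtain rfl : r' = r + 1 := by omega
      subst h₄
      have h : br (l' + 2 + (r + 1)) k [⟨l' + 2, .vertex 0 (q' + 2), r + 1⟩,
            ⟨l' + 2 + (q' + 1), .cup, r⟩]
          = br (l' + 2 + (r + 1)) k [⟨l' + 2, .vertex 1 (q' + 1), r⟩] :=
        br_step [] [] (.bend_right (l' + 2) 0 (q' + 1) r)
      rw [show l' + q' + 1 + 2 = l' + 2 + (q' + 1) by omega, br_append hw.composable h]
      exact hw.vertex_one_mem _ _ _ _ (by omega) (by omega)
    · obtain ⟨m, rfl⟩ : ∃ m, l = l' + q' + 2 + m := ⟨l - l' - q' - 2, by omega⟩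
      have h : br (l' + 2 + r') k [⟨l' + 2, .vertex 0 (q' + 2), r'⟩,
            ⟨l' + q' + 2 + m + 2, .cup, r⟩]
          = br (l' + 2 + r') k [⟨l' + m + 2, .cup, r⟩,
            ⟨l' + 2, .vertex 0 (q' + 2), m + r⟩] := br_step [] [] (.interchange_of m)
      rw [br_append hw.composable h, ← List.singleton_append, ← List.append_assoc]
      exact creationSpan_vertex l' (q' + 2) (m + r) rfl (by omega)
        (ih (l' + m) r _ (by omega) (by omega))

theorem creationSpan_cup (l r : ℕ) {n k : ℕ} (hn : n = l + 4 + r) (hk : k = l + 2 + r)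
    {w : List Layer} (hw : br 2 n w ∈ creationSpan n) :
    br 2 k (w ++ [⟨l + 2, .cup, r⟩]) ∈ creationSpan k :=
  creationSpan_post _ (by simp only [Layer.top, Piece.top]; omega)
    (by simp only [Layer.bot, Piece.bot]; omega) (fun _ hw => hw.cup_mem l r k hn hk) hw

/-- The span of creations is closed under all vertices: bend the upper germs down. -/
theorem creationSpan_vertex_all (p l q r : ℕ) {n k : ℕ} (hn : n = l + 2 + p + r)
    (hk : k = l + 2 + q + r) {w : List Layer} (hw : br 2 n w ∈ creationSpan n) :
    br 2 k (w ++ [⟨l + 2, .vertex p q, r⟩]) ∈ creationSpan k := by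
  induction p generalizing l q k w with
  | zero => exact creationSpan_vertex l q r hn hk hw
  | succ p ih =>
    refine creationSpan_post ⟨l + 2, .vertex (p + 1) q, r⟩ hn.symm hk.symm (fun w hw => ?_) hw
    have h : br n k [⟨l + 2 + 1, .vertex p (q + 1), r⟩, ⟨l + 2, .cup, q + r⟩]
        = br n k [⟨l + 2, .vertex (p + 1) q, r⟩] := br_step [] [] (.bend_left (l + 2) p q r)
    rw [br_append hw.composable h.symm, ← List.singleton_append, ← List.append_assoc]
    exact creationSpan_cup l (q + r) (n := l + 4 + q + r) (by omega) (by omega)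
      (ih (l + 1) (q + 1) (by omega) (by omega) hw.mem)

/-- The span of creations is closed under all layers which lie to the right of two strands. -/
theorem creationSpan_layer (L : Layer) (hL : 2 ≤ L.left) {n k : ℕ} (hn : L.top = n)
    (hk : L.bot = k) {w : List Layer} (hw : br 2 n w ∈ creationSpan n) :
    br 2 k (w ++ [L]) ∈ creationSpan k := by
  obtain ⟨l, g, r⟩ := L
  obtain ⟨l, rfl⟩ : ∃ m, l = m + 2 := ⟨l - 2, by simp only at hL; omega⟩
  refine creationSpan_post _ hn hk (fun w hw => ?_) hw
  cases g with
  | cap =>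
    simp only [Layer.top, Layer.bot, Piece.top, Piece.bot] at hn hk
    rw [br_append hw.composable (br_cap (l + 2) r (by omega) (by omega))]
    exact creationSpan_vertex l 2 r (by omega) (by omega) hw.mem
  | cup =>
    simp only [Layer.top, Layer.bot, Piece.top, Piece.bot] at hn hk
    exact creationSpan_cup l r (by omega) (by omega) hw.mem
  | vertex p q => exact creationSpan_vertex_all p l q r hn.symm hk.symm hw.mem
  | crossing b =>
    simp only [Layer.top, Layer.bot, Piece.top, Piece.bot] at hn hk
    obtain rfl : n = k := by omega
    rw [← pre_br _ w hw.composable, br_crossing (l + 2) b r hn.symm hn.symm, map_sub, map_add,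
      map_smul, map_smul, map_smul, pre_br, pre_br, pre_br, List.append_nil]
    refine Submodule.sub_mem _ (Submodule.add_mem _ (Submodule.smul_mem _ _ hw.mem)
      (Submodule.smul_mem _ _ ?_)) (Submodule.smul_mem _ _ ?_)
    · have h := br_append (n := n) (hw.composable.append (v := [⟨l + 2, .cup, r⟩])
        (k := l + 2 + r) ⟨hn, rfl⟩) (br_cap (l + 2) r rfl hn.symm)
      rw [List.append_assoc, List.append_assoc, List.singleton_append] at h
      rw [h, ← List.singleton_append, ← List.append_assoc]
      exact creationSpan_vertex l 2 r rfl hn.symm (creationSpan_cup l r (by omega) rfl hw.mem)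
    · exact creationSpan_vertex_all 2 l 2 r hn.symm hn.symm hw.mem

theorem creationSpan_word (y : List Layer) (hL : ∀ L ∈ y, 2 ≤ L.left) {n k : ℕ}
    (hy : Composable n y k) {w : List Layer} (hw : br 2 n w ∈ creationSpan n) :
    br 2 k (w ++ y) ∈ creationSpan k := by
  induction y generalizing n w with
  | nil =>
    obtain rfl : n = k := hy
    rwa [List.append_nil]
  | cons L y ih =>
    rw [← List.singleton_append, ← List.append_assoc]
    exact ih (fun L' hL' => hL L' (List.mem_cons_of_mem _ hL')) hy.2
      (creationSpan_layer L (hL L List.mem_cons_self) hy.1 rfl hw)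

theorem Creation.cases_iff {n : ℕ} {w : List Layer} (h : Creation n w) :
    (n = 2 ∧ w = []) ∨ ∃ l q r w', n = l + 2 + (q + 2) + r ∧ Creation (l + 2 + r) w' ∧
      w = w' ++ [⟨l + 2, .vertex 0 (q + 2), r⟩] := by
  cases h with
  | nil => exact .inl ⟨rfl, rfl⟩
  | snoc l q r hw => exact .inr ⟨l, q, r, _, rfl, hw, rfl⟩

theorem creation_four {w : List Layer} (h : Creation 4 w) : w = [⟨2, .vertex 0 2, 0⟩] := by
  rcases h.cases_iff with ⟨h, -⟩ | ⟨l, q, r, w', hn, hw, rfl⟩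
  · omega
  · obtain ⟨rfl, rfl, rfl⟩ : l = 0 ∧ q = 0 ∧ r = 0 := by omega
    rcases hw.cases_iff with ⟨-, rfl⟩ | ⟨l, q, r, w', hn, -, -⟩
    · rfl
    · omega

theorem creation_six {w : List Layer} (h : Creation 6 w) : w = [⟨2, .vertex 0 4, 0⟩] ∨
    ∃ l r, l + r = 2 ∧ w = [⟨2, .vertex 0 2, 0⟩, ⟨l + 2, .vertex 0 2, r⟩] := by
  rcases h.cases_iff with ⟨h, -⟩ | ⟨l, q, r, w', hn, hw, rfl⟩
  · omega
  · rcases hw.cases_iff with ⟨h', rfl⟩ | ⟨l', q', r', w'', hn', hw', rfl⟩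
    · obtain ⟨rfl, rfl, rfl⟩ : l = 0 ∧ q = 2 ∧ r = 0 := by omega
      exact .inl rfl
    · obtain ⟨rfl, h₂⟩ : q = 0 ∧ l + r = 2 := by omega
      have h₄ : l + 2 + r = 4 := by omega
      rw [h₄] at hw
      exact .inr ⟨l, r, h₂, by rw [creation_four hw]; rfl⟩

/-! ### Closing up -/

/-- The same layers with `k` more vertical strands on the left. -/
def addLeft (k : ℕ) (w : List Layer) : List Layer :=
  w.map fun L => ⟨L.left + k, L.piece, L.right⟩

theorem composable_addLeft (k : ℕ) {m n : ℕ} {w : List Layer} (h : Composable m w n) :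
    Composable (k + m) (addLeft k w) (k + n) := by
  induction w generalizing m with
  | nil =>
    obtain rfl : m = n := h
    rfl
  | cons L w ih =>
    obtain ⟨rfl, h⟩ := h
    refine ⟨?_, ?_⟩
    · simp only [Layer.top]; omega
    · have e := ih h
      rwa [show k + L.bot = Layer.bot ⟨L.left + k, L.piece, L.right⟩ by
        simp only [Layer.bot]; omega] at e

/-- A minimum may be moved above layers which lie to its right. -/
theorem br_cup_addLeft (k j : ℕ) {m n : ℕ} {w : List Layer} (h : Composable m w n) :
    br (k + 2 + j + m) (k + j + n) (addLeft (k + 2 + j) w ++ [⟨k, .cup, j + n⟩])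
      = br (k + 2 + j + m) (k + j + n) ([⟨k, .cup, j + m⟩] ++ addLeft (k + j) w) := by
  induction w generalizing m with
  | nil =>
    obtain rfl : m = n := h
    rfl
  | cons L w ih =>
    obtain ⟨l, g, r⟩ := L
    obtain ⟨rfl, h⟩ := h
    have h₁ : Composable (k + 2 + j + (l + g.top + r)) [⟨l + (k + 2 + j), g, r⟩]
        (k + 2 + j + (l + g.bot + r)) := by
      constructor <;> simp only [Composable, Layer.top, Layer.bot] <;> omega
    have h₂ := br_append h₁ (ih h)
    have h₄ : Composable (Layer.bot ⟨l + (k + j), g, r⟩) (addLeft (k + j) w) (k + j + n) := by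
      have e := composable_addLeft (k + j) h
      rwa [show k + j + Layer.bot ⟨l, g, r⟩ = Layer.bot ⟨l + (k + j), g, r⟩ by
        simp only [Layer.bot]; omega] at e
    have h₃ := br_step (m := k + 2 + j + (l + g.top + r)) (n := k + j + n) []
      (addLeft (k + j) w) (.interchange_of (l := k) (r := r)
        (r₁ := j + (l + g.top + r)) (r₂ := j + (l + g.bot + r)) (l₁ := l + (k + 2 + j))
        (l₂ := l + (k + j)) (g := .cup) (h := g) (l + j))
      ⟨by simp only [Layer.top, Piece.top]; omega, by
        simp only [Layer.top, Layer.bot, Piece.bot]; omega, h₄⟩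
      ⟨by simp only [Layer.top]; omega, by
        simp only [Layer.top, Layer.bot, Piece.top]; omega, by
        rwa [show Layer.bot ⟨k, .cup, j + (l + g.bot + r)⟩ = Layer.bot ⟨l + (k + j), g, r⟩ by
          simp only [Layer.bot, Piece.bot]; omega]⟩
    exact h₂.trans h₃.symm

/-- Straightening the two strands at the top right, any diagram of the skein algebra of two strands
is obtained by closing up one whose layers lie to the right of two vertical strands. -/
theorem br_eq_close {w : List Layer} (h : Composable 2 w 2) : br 2 2 w =
    br 2 2 ([⟨2, .cap, 0⟩, ⟨3, .cap, 1⟩] ++ addLeft 4 w ++ [⟨1, .cup, 3⟩, ⟨0, .cup, 2⟩]) := by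
  have h₁ : Composable 2 [⟨2, .cap, 0⟩, ⟨3, .cap, 1⟩] 6 := ⟨rfl, rfl, rfl⟩
  have h₂ := br_cup_addLeft 1 1 h
  have h₃ := br_cup_addLeft 0 0 h
  simp only [Nat.reduceAdd] at h₂ h₃
  have h₄ : Composable 4 [⟨0, .cup, 2⟩] 2 := ⟨rfl, rfl⟩
  have h₅ : Composable 6 [⟨1, .cup, 3⟩] 4 := ⟨rfl, rfl⟩
  have h₆ := congrArg (post 6 _ h₄) h₂
  rw [post_br, post_br] at h₆
  have h₇ := br_append h₁ h₆
  have h₈ := br_append (h₁.append h₅) h₃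
  have h₉ : br 2 2 ([⟨2, .cap, 0⟩, ⟨3, .cap, 1⟩, ⟨1, .cup, 3⟩, ⟨0, .cup, 2⟩] : List Layer)
      = br 2 2 [] := by
    calc _ = br 2 2 ([⟨2, .cap, 0⟩, ⟨1, .cup, 1⟩, ⟨1, .cap, 1⟩, ⟨0, .cup, 2⟩] : List Layer) :=
          (br_step [⟨2, .cap, 0⟩] [⟨0, .cup, 2⟩] (.interchange_of 0)).symm
      _ = br 2 2 ([⟨1, .cap, 1⟩, ⟨0, .cup, 2⟩] : List Layer) :=
          br_step [] [⟨1, .cap, 1⟩, ⟨0, .cup, 2⟩] (.snake_left 1 0)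
      _ = br 2 2 [] := br_step [] [] (.snake_left 0 1)
  have h₁₀ := congrArg (post 2 w h) h₉
  rw [post_br, post_br, List.nil_append] at h₁₀
  rw [← h₁₀]
  have hw : addLeft 0 w = w := by simp [addLeft]
  rw [hw] at h₈
  simp only [List.append_assoc, List.cons_append, List.nil_append] at h₇ h₈ ⊢
  rw [h₇, h₈]

/-- Closing up a creation yields `X`, `1` or `V`. -/
theorem close_mem {w : List Layer} (hw : br 2 6 w ∈ creationSpan 6) :
    br 2 2 (w ++ [⟨1, .cup, 3⟩, ⟨0, .cup, 2⟩]) ∈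
      Submodule.span SkeinRing {br 2 2 [], br 2 2 [⟨0, .vertex 2 2, 0⟩],
        br 2 2 [⟨0, .cup, 0⟩, ⟨0, .cap, 0⟩]} := by
  have hy : Composable 6 [⟨1, .cup, 3⟩, ⟨0, .cup, 2⟩] 2 := ⟨rfl, rfl, rfl⟩
  rw [← post_br 2 _ hy]
  refine map_mem_of_creation (fun w hw => Submodule.subset_span ?_) hw
  rw [post_br]
  have side : br 2 2 ([⟨2, .vertex 0 2, 0⟩, ⟨4, .vertex 0 2, 0⟩, ⟨1, .cup, 3⟩, ⟨0, .cup, 2⟩] :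
      List Layer) = br 2 2 [⟨0, .cup, 0⟩, ⟨0, .cap, 0⟩] := by
    calc _ = br 2 2 ([⟨2, .vertex 0 2, 0⟩, ⟨1, .cup, 1⟩, ⟨2, .vertex 0 2, 0⟩, ⟨0, .cup, 2⟩] :
            List Layer) :=
          (br_step [⟨2, .vertex 0 2, 0⟩] [⟨0, .cup, 2⟩] (.interchange_of 1)).symm
      _ = br 2 2 ([⟨1, .vertex 1 1, 0⟩, ⟨2, .vertex 0 2, 0⟩, ⟨0, .cup, 2⟩] : List Layer) :=
          br_step [] [⟨2, .vertex 0 2, 0⟩, ⟨0, .cup, 2⟩] (.bend_left 1 0 1 0)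
      _ = br 2 2 ([⟨2, .vertex 0 2, 0⟩, ⟨0, .cup, 2⟩] : List Layer) :=
          br_step [] [⟨2, .vertex 0 2, 0⟩, ⟨0, .cup, 2⟩] (.two_valent 1 0)
      _ = br 2 2 ([⟨0, .cup, 0⟩, ⟨0, .vertex 0 2, 0⟩] : List Layer) :=
          (br_step [] [] (.interchange_of 0)).symm
      _ = br 2 2 [⟨0, .cup, 0⟩, ⟨0, .cap, 0⟩] :=
          (br_append (show Composable 2 [⟨0, .cup, 0⟩] 0 from ⟨rfl, rfl⟩) (br_cap 0 0 rfl rfl)).symm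
  rcases creation_six hw with rfl | ⟨l, r, hlr, rfl⟩
  · right; left
    calc _ = br 2 2 ([⟨1, .vertex 1 3, 0⟩, ⟨0, .cup, 2⟩] : List Layer) :=
          br_step [] [⟨0, .cup, 2⟩] (.bend_left 1 0 3 0)
      _ = _ := br_step [] [] (.bend_left 0 1 2 0)
  · have hl : l = 0 ∨ l = 1 ∨ l = 2 := by omega
    rcases hl with rfl | rfl | rfl
    · obtain rfl : r = 2 := by omega
      right; right
      refine Eq.trans ?_ side
      exact (br_step [] [⟨1, .cup, 3⟩, ⟨0, .cup, 2⟩] (.interchange_of 0)).symm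
    · obtain rfl : r = 1 := by omega
      left
      calc _ = br 2 2 ([⟨2, .vertex 0 2, 0⟩, ⟨1, .cup, 1⟩, ⟨1, .vertex 0 2, 1⟩, ⟨0, .cup, 2⟩] :
              List Layer) :=
            (br_step [⟨2, .vertex 0 2, 0⟩] [⟨0, .cup, 2⟩] (.interchange_of 0)).symm
        _ = br 2 2 ([⟨1, .vertex 1 1, 0⟩, ⟨1, .vertex 0 2, 1⟩, ⟨0, .cup, 2⟩] : List Layer) :=
            br_step [] [⟨1, .vertex 0 2, 1⟩, ⟨0, .cup, 2⟩] (.bend_left 1 0 1 0)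
        _ = br 2 2 ([⟨1, .vertex 0 2, 1⟩, ⟨0, .cup, 2⟩] : List Layer) :=
            br_step [] [⟨1, .vertex 0 2, 1⟩, ⟨0, .cup, 2⟩] (.two_valent 1 0)
        _ = br 2 2 ([⟨0, .vertex 1 1, 1⟩] : List Layer) := br_step [] [] (.bend_left 0 0 1 1)
        _ = br 2 2 [] := br_step [] [] (.two_valent 0 1)
    · obtain rfl : r = 0 := by omega
      exact .inr (.inr side)

/-- Every diagram of the skein algebra of two strands is a combination of `1`, `X` and `V`. -/
theorem br_mem_span {w : List Layer} (h : Composable 2 w 2) : br 2 2 w ∈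
    Submodule.span SkeinRing {br 2 2 [], br 2 2 [⟨0, .vertex 2 2, 0⟩],
        br 2 2 [⟨0, .cup, 0⟩, ⟨0, .cap, 0⟩]} := by
  rw [br_eq_close h]
  refine close_mem ?_
  have h₁ : Composable 2 ([⟨2, .cap, 0⟩, ⟨3, .cap, 1⟩] ++ addLeft 4 w) 6 :=
    Composable.append (n := 6) ⟨rfl, rfl, rfl⟩ (composable_addLeft 4 h)
  refine creationSpan_word _ ?_ h₁ (w := []) Creation.nil.mem
  intro L hL
  simp only [addLeft, List.cons_append, List.nil_append, List.mem_cons, List.mem_map] at hL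
  rcases hL with rfl | rfl | ⟨L, -, rfl⟩
  · exact le_rfl
  · exact Nat.le_succ 2
  · exact Nat.le_add_left_of_le (by norm_num)

/-- Evaluation of a function on contexts at the trivial context. -/
def evalNil : Ctx 2 2 →ₗ[SkeinRing] SkeinAlgebra 2 where
  toFun F := F ⟨[], rfl⟩ ⟨[], rfl⟩
  map_add' _ _ := rfl
  map_smul' _ _ := rfl

theorem evalNil_br (x : LayeredDiagram 2) : evalNil (br 2 2 x.1) = skeinClass x := by
  change cls ([] ++ x.1 ++ []) = _
  rw [List.nil_append, List.append_nil, cls_eq x.2]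
  rfl

theorem skeinClass_one {n : ℕ} : skeinClass (1 : LayeredDiagram n) = 1 := by
  have : basis (1 : LayeredDiagram n) = 1 := map_one (MonoidAlgebra.of SkeinRing (RibbonGraph n))
  rw [skeinClass, this, map_one]

theorem evalNil_nil : evalNil (br 2 2 []) = 1 := (evalNil_br 1).trans skeinClass_one

theorem evalNil_X : evalNil (br 2 2 [⟨0, .vertex 2 2, 0⟩]) = elementX := evalNil_br diagramX

theorem evalNil_V : evalNil (br 2 2 [⟨0, .cup, 0⟩, ⟨0, .cap, 0⟩]) = elementV :=
  evalNil_br diagramV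

theorem skein_span_eq_top :
    Submodule.span SkeinRing {(1 : SkeinAlgebra 2), elementX, elementV} = ⊤ := by
  have key : ∀ x : LayeredDiagram 2,
      skeinClass x ∈ Submodule.span SkeinRing {(1 : SkeinAlgebra 2), elementX, elementV} := by
    intro x
    have h := Submodule.mem_map_of_mem (f := evalNil) (br_mem_span x.2)
    rwa [evalNil_br, Submodule.map_span, Set.image_insert_eq, Set.image_insert_eq,
      Set.image_singleton, evalNil_nil, evalNil_X, evalNil_V] at h
  rw [eq_top_iff]
  rintro y -
  obtain ⟨f, rfl⟩ := Ideal.Quotient.mk_surjective y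
  induction f using MonoidAlgebra.induction_on with
  | of g =>
    obtain ⟨x, hx⟩ := exists_basis g
    rw [hx]
    exact key x
  | add a b ha hb => rw [map_add]; exact Submodule.add_mem _ ha hb
  | smul c a ha => exact Submodule.smul_mem _ c ha

/-! ### The relations -/

theorem skeinClass_mul (x y : LayeredDiagram 2) :
    skeinClass x * skeinClass y = evalNil (br 2 2 (x.1 ++ y.1)) := by
  rw [skeinClass, skeinClass, ← map_mul, basis_mul]
  exact (evalNil_br (x * y)).symm

theorem elementV_mul_elementV : elementV * elementV = (d ^ 2 - 1) • elementV := by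
  have e : elementV * elementV =
      evalNil (br 2 2 [⟨0, .cup, 0⟩, ⟨0, .cap, 0⟩, ⟨0, .cup, 0⟩, ⟨0, .cap, 0⟩]) :=
    skeinClass_mul _ _
  have h₁ : Composable 2 [⟨0, .cup, 0⟩] 0 := ⟨rfl, rfl⟩
  have h₂ : Composable 0 [⟨0, .cap, 0⟩] 2 := ⟨rfl, rfl⟩
  have h := congrArg (fun F => pre 2 _ h₁ (post 0 _ h₂ F))
    (br_circle 0 0 (m := 0) (n := 0) rfl rfl)
  simp only [map_smul, post_br, pre_br, List.cons_append, List.nil_append] at h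
  rw [e, h, map_smul, evalNil_V]

theorem elementX_mul_elementV : elementX * elementV = (d - dinv) • elementV := by
  have e : elementX * elementV =
      evalNil (br 2 2 [⟨0, .vertex 2 2, 0⟩, ⟨0, .cup, 0⟩, ⟨0, .cap, 0⟩]) :=
    skeinClass_mul _ _
  have h₁ : Composable 0 [⟨0, .cap, 0⟩] 2 := ⟨rfl, rfl⟩
  have h := congrArg (post 2 _ h₁) (br_loop 0 2 0 (m := 2) (n := 0) rfl rfl)
  rw [← br_cup 0 0 (m := 2) (n := 0) rfl rfl] at h
  simp only [map_smul, post_br, List.cons_append, List.nil_append] at h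
  rw [e, h, map_smul, evalNil_V]

theorem elementV_mul_elementX : elementV * elementX = (d - dinv) • elementV := by
  have e : elementV * elementX =
      evalNil (br 2 2 [⟨0, .cup, 0⟩, ⟨0, .cap, 0⟩, ⟨0, .vertex 2 2, 0⟩]) :=
    skeinClass_mul _ _
  have h₁ : br 0 2 ([⟨0, .cap, 0⟩, ⟨0, .vertex 2 2, 0⟩] : List Layer)
      = (d - dinv) • br 0 2 [⟨0, .cap, 0⟩] := by
    calc _ = br 0 2 ([⟨0, .cap, 0⟩, ⟨1, .vertex 1 3, 0⟩, ⟨0, .cup, 2⟩] : List Layer) :=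
          (br_step [⟨0, .cap, 0⟩] [] (.bend_left 0 1 2 0)).symm
      _ = br 0 2 ([⟨0, .vertex 0 4, 0⟩, ⟨0, .cup, 2⟩] : List Layer) :=
          br_unbend_left_append 0 0 3 0 [⟨0, .cup, 2⟩] rfl rfl ⟨rfl, rfl⟩
      _ = (d - dinv) • br 0 2 [⟨0, .vertex 0 2, 0⟩] := br_loop_at 0 0 0 2 0 rfl rfl rfl rfl
      _ = _ := by rw [br_cap 0 0 rfl rfl]
  have h₂ : Composable 2 [⟨0, .cup, 0⟩] 0 := ⟨rfl, rfl⟩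
  have h := congrArg (pre 2 _ h₂) h₁
  simp only [map_smul, pre_br, List.cons_append, List.nil_append] at h
  rw [e, h, map_smul, evalNil_V]

theorem elementX_mul_elementX :
    elementX * elementX = (d - 2 * dinv) • elementX + dinv ^ 2 • elementV := by
  have e : elementX * elementX = evalNil (br 2 2 [⟨0, .vertex 2 2, 0⟩, ⟨0, .vertex 2 2, 0⟩]) :=
    skeinClass_mul _ _
  have hV : br 2 2 [⟨0, .vertex 2 0, 0⟩, ⟨0, .vertex 0 2, 0⟩]
      = br 2 2 [⟨0, .cup, 0⟩, ⟨0, .cap, 0⟩] := by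
    have hy : Composable 0 [⟨0, .vertex 0 2, 0⟩] 2 := ⟨rfl, rfl⟩
    have hx : Composable 2 [⟨0, .cup, 0⟩] 0 := ⟨rfl, rfl⟩
    have h₁ := congrArg (post 2 _ hy) (br_cup 0 0 (m := 2) (n := 0) rfl rfl)
    have h₂ := congrArg (pre 2 _ hx) (br_cap 0 0 (m := 0) (n := 2) rfl rfl)
    simp only [post_br, pre_br, List.cons_append, List.nil_append] at h₁ h₂
    exact h₁.symm.trans h₂.symm
  have h₁ : br 2 2 [⟨0, .vertex 2 2, 0⟩, ⟨1, .vertex 1 3, 0⟩, ⟨0, .cup, 2⟩]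
      = br 2 2 [⟨0, .vertex 2 2, 0⟩, ⟨0, .vertex 2 2, 0⟩] :=
    br_step [⟨0, .vertex 2 2, 0⟩] [] (.bend_left 0 1 2 0)
  have hy : Composable 4 [⟨0, .cup, 2⟩] 2 := ⟨rfl, rfl⟩
  have h₂ := congrArg (post 2 _ hy)
    (br_contract 0 2 1 3 0 0 (m := 2) (n := 4) (k := 0) (j := 1) rfl rfl rfl rfl)
  have h₃ : br 2 2 [⟨0, .vertex 2 4, 0⟩, ⟨0, .cup, 2⟩]
      = (d - dinv) • br 2 2 [⟨0, .vertex 2 2, 0⟩] := br_loop_at 0 2 0 2 0 rfl rfl rfl rfl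
  have h₄ : br 2 2 [⟨0, .vertex 2 1, 0⟩, ⟨1, .vertex 0 3, 0⟩, ⟨0, .cup, 2⟩]
      = br 2 2 [⟨0, .vertex 2 1, 0⟩, ⟨0, .vertex 1 2, 0⟩] :=
    br_step [⟨0, .vertex 2 1, 0⟩] [] (.bend_left 0 0 2 0)
  simp only [map_sub, map_smul, post_br, List.cons_append, List.nil_append, Nat.reduceAdd, h₁, h₃,
    h₄, br_del_contr 0 2 2 0 (m := 2) (n := 2) rfl rfl, hV] at h₂
  rw [e, h₂]
  simp only [map_sub, map_smul, evalNil_X, evalNil_V]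
  rw [smul_sub, smul_smul, ← sub_add, ← sub_smul, ← sq, sub_sub, two_mul]

/-! ### The presentation -/

open scoped IsMulCommutative in
/-- Two commuting elements of an algebra define a homomorphism from the polynomial algebra in two
variables. -/
theorem exists_algHom_of_commute {R B : Type*} [CommRing R] [Ring B] [Algebra R B] {x y : B}
    (h : Commute x y) :
    ∃ f : MvPolynomial (Fin 2) R →ₐ[R] B, f (MvPolynomial.X 0) = x ∧ f (MvPolynomial.X 1) = y := by
  have hcomm : ∀ a ∈ ({x, y} : Set B), ∀ b ∈ ({x, y} : Set B), a * b = b * a := by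
    rintro a (rfl | rfl) b (rfl | rfl)
    exacts [rfl, h, h.symm, rfl]
  have := Algebra.isMulCommutative_adjoin R hcomm
  let g : MvPolynomial (Fin 2) R →ₐ[R] Algebra.adjoin R ({x, y} : Set B) :=
    MvPolynomial.aeval ![⟨x, Algebra.subset_adjoin (by simp)⟩, ⟨y, Algebra.subset_adjoin (by simp)⟩]
  refine ⟨(Algebra.adjoin R {x, y}).val.comp g, ?_, ?_⟩ <;> simp [g]

/-- The quotient of the polynomial algebra by the three relations. -/
abbrev PresentedAlgebra : Type := MvPolynomial (Fin 2) SkeinRing ⧸ relationIdeal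

/-- The quotient map, as a homomorphism of algebras over the coefficient ring. -/
def presented : MvPolynomial (Fin 2) SkeinRing →ₐ[SkeinRing] PresentedAlgebra :=
  Ideal.Quotient.mkₐ SkeinRing relationIdeal

theorem presented_VV : presented varV * presented varV = (d ^ 2 - 1) • presented varV := by
  rw [← map_mul, ← sq, ← map_smul]
  exact Ideal.Quotient.eq.2 (Ideal.subset_span (by simp))

theorem presented_VX : presented varV * presented varX = (d - dinv) • presented varV := by
  rw [← map_mul, ← map_smul]
  exact Ideal.Quotient.eq.2 (Ideal.subset_span (by simp))

theorem presented_XX : presented varX * presented varX =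
    (d - 2 * dinv) • presented varX + dinv ^ 2 • presented varV := by
  rw [← map_mul, ← sq, ← map_smul, ← map_smul, ← map_add]
  refine Ideal.Quotient.eq.2 ?_
  rw [← sub_sub]
  exact Ideal.subset_span (by simp)

/-- The three relations reduce every polynomial to a combination of `1`, `X` and `V`. -/
theorem presented_eq (p : MvPolynomial (Fin 2) SkeinRing) : ∃ a b c : SkeinRing,
    presented p = a • 1 + b • presented varX + c • presented varV := by
  induction p using MvPolynomial.induction_on with
  | C r =>
    refine ⟨r, 0, 0, ?_⟩
    rw [zero_smul, zero_smul, add_zero, add_zero, ← Algebra.algebraMap_eq_smul_one]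
    rfl
  | add p q hp hq =>
    obtain ⟨a, b, c, hp⟩ := hp
    obtain ⟨a', b', c', hq⟩ := hq
    refine ⟨a + a', b + b', c + c', ?_⟩
    rw [map_add, hp, hq, add_smul, add_smul, add_smul]
    abel
  | mul_X p i hp =>
    obtain ⟨a, b, c, hp⟩ := hp
    rw [map_mul, hp, add_mul, add_mul, smul_mul_assoc, smul_mul_assoc, smul_mul_assoc, one_mul]
    obtain rfl | rfl : i = 0 ∨ i = 1 := by omega
    · refine ⟨0, a + b * (d - 2 * dinv), b * dinv ^ 2 + c * (d - dinv), ?_⟩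
      rw [← varX, presented_XX, presented_VX, smul_add, smul_smul, smul_smul, smul_smul, zero_smul,
        zero_add, add_smul, add_smul, ← add_assoc, ← add_assoc]
    · refine ⟨0, 0, a + b * (d - dinv) + c * (d ^ 2 - 1), ?_⟩
      rw [← varV, mul_comm (presented varX), presented_VX, presented_VV, smul_smul, smul_smul,
        zero_smul, zero_smul, zero_add, zero_add, add_smul, add_smul]

/-- The isomorphism: the homomorphism from the presented algebra is surjective as `1`, `X`, `V` span
the skein algebra, and injective as they are linearly independent. -/
theorem exists_presentation : ∃ e : PresentedAlgebra ≃ₐ[SkeinRing] SkeinAlgebra 2,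
    e (presented varX) = elementX ∧ e (presented varV) = elementV := by
  obtain ⟨f, hX, hV⟩ := exists_algHom_of_commute (R := SkeinRing) (x := elementX) (y := elementV)
    (elementX_mul_elementV.trans elementV_mul_elementX.symm)
  have hX : f varX = elementX := hX
  have hV : f varV = elementV := hV
  have hker : ∀ p ∈ relationIdeal, f p = 0 := by
    have h : relationIdeal ≤ RingHom.ker f := by
      refine Ideal.span_le.2 ?_
      rintro _ (rfl | rfl | rfl)
      · change f _ = 0
        rw [map_sub, map_smul, map_pow, hV, sq, elementV_mul_elementV, sub_self]
      · change f _ = 0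
        rw [map_sub, map_smul, map_mul, hV, hX, elementV_mul_elementX, sub_self]
      · change f _ = 0
        rw [map_sub, map_sub, map_smul, map_smul, map_pow, hV, hX, sq, elementX_mul_elementX]
        abel
    exact fun p hp => h hp
  let g : PresentedAlgebra →ₐ[SkeinRing] SkeinAlgebra 2 := Ideal.Quotient.liftₐ relationIdeal f hker
  have gX : g (presented varX) = elementX := hX
  have gV : g (presented varV) = elementV := hV
  refine ⟨AlgEquiv.ofBijective g ⟨?_, ?_⟩, gX, gV⟩
  · rw [injective_iff_map_eq_zero]
    intro y hy
    obtain ⟨p, rfl⟩ := Ideal.Quotient.mk_surjective y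
    obtain ⟨a, b, c, hp⟩ := presented_eq p
    change g (presented p) = 0 at hy
    rw [hp, map_add, map_add, map_smul, map_smul, map_smul, map_one, gX, gV] at hy
    obtain ⟨rfl, rfl, rfl⟩ := skein_independent hy
    change presented p = 0
    rw [hp, zero_smul, zero_smul, zero_smul, add_zero, add_zero]
  · have h : (⊤ : Submodule SkeinRing (SkeinAlgebra 2)) ≤ LinearMap.range g.toLinearMap := by
      rw [← skein_span_eq_top, Submodule.span_le]
      rintro _ (rfl | rfl | rfl)
      exacts [⟨1, map_one g⟩, ⟨presented varX, gX⟩, ⟨presented varV, gV⟩]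
    exact fun y => h (Submodule.mem_top (x := y))

end

end RibbonSkein

/-- The skein algebra `𝒴₂` is isomorphic, as an algebra over `ℤ[A^{±1}, d⁻¹]`, to the quotient of
the polynomial algebra in `X` and `V` by the three relations; the variables `X` and `V` correspond
to the diagrams of the same name. -/
theorem corollary1p1 :
    ∃ e : (MvPolynomial (Fin 2) RibbonSkein.SkeinRing ⧸ RibbonSkein.relationIdeal)
        ≃ₐ[RibbonSkein.SkeinRing] RibbonSkein.SkeinAlgebra 2,
      e (Ideal.Quotient.mk RibbonSkein.relationIdeal RibbonSkein.varX) = RibbonSkein.elementX ∧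
      e (Ideal.Quotient.mk RibbonSkein.relationIdeal RibbonSkein.varV) = RibbonSkein.elementV := by
  exact RibbonSkein.exists_presentation
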